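/- Let $0<\alpha<1$. Let $\Omega\subset\mathbb R^d$ ($d=1,2,3$) be a bounded convex polygonal domain, $\mathcal T_h$ a conforming triangulation of $\Omega$ into $d$-simplexes, $X_h\subset H^1_0(\Omega)$ the space of (complex-valued) functions that are affine on each simplex, equipped with the $L^2(\Omega)$-norm, and $A_h=-\Delta_h:X_h\to X_h$ the discrete Laplacian defined by $(A_h\varphi,\chi)=(\nabla\varphi,\nabla\chi)$ for all $\varphi,\chi\in X_h$. For $\theta\in(\pi/2,\pi)$ and $\delta,\tau>0$ let $$\Gamma_{\theta,\delta}=\{|z|=\delta,\ |\arg z|\le\theta\}\cup\{\rho e^{\pm i\theta}:\rho\ge\delta\},\qquad \Gamma_\tau=\{z\in\Gamma_{\theta,\delta}:|\Im z|\le\pi/\tau\}.$$ Let $\mathrm{Li}_{\alpha-1}$ be the analytic continuation of $\sum_{j\ge1}j^{1-\alpha}\xi^j$ from $|\xi|<1$ to $\mathbb C\setminus[1,\infty)$, and set $$\psi(w)=\frac{e^{w}-1}{\Gamma(2-\alpha)}\,\mathrm{Li}_{\alpha-1}(e^{-w}),\qquad \chi_1(z)=\frac{1-e^{-z\tau}}{\tau^\alpha}\,\psi(z\tau),$$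 $$K_1(z)=-z^{-1}(z^\alpha I+A_h)^{-1}A_h,\qquad K_2(z)=-\frac{\tau}{1-e^{-z\tau}}\bigl(\chi_1(z)I+A_h\bigr)^{-1}A_h ,$$ with the principal branch of $z^\alpha$. Then there is $\theta_0\in(\pi/2,\pi]$, depending only on $\alpha$, such that for every $\theta\in(\pi/2,\theta_0)$ there is a constant $c>0$, depending only on $\alpha$ and $\theta$ (in particular not on $\Omega$, the triangulation, $\tau$ or $\delta$), with the following property. For all such $\Omega$ and $\mathcal T_h$, all $\tau>0$, all $0<\delta<\pi/(2\tau)$ and all $z\in\Gamma_\tau$, the kernels are well defined, i.e. $e^{-z\tau}\notin[1,\infty)$ and both $z^\alpha I+A_h$ and $\chi_1(z)I+A_h$ are invertible on $X_h$, and in the operator norm of $X_h$ $$\|K_1(z)-K_2(z)\|\le c\,\tau .$$ -/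

import Mathlib

open MeasureTheory Set Filter Topology
open scoped ContDiff

noncomputable section

namespace L1Scheme

/-! ### The polylogarithm -/

/-- The split complex plane `ℂ ∖ [1, ∞)`. -/
def splitPlane : Set ℂ := ((fun x : ℝ => (x : ℂ)) '' Ici 1)ᶜ

/-- `L` is the polylogarithm of order `p`: it is holomorphic on the split plane, and on the unit
disc it is the sum of the series `∑_{j ≥ 1} ξ ^ j / j ^ p`. -/
structure IsPolylog (p : ℝ) (L : ℂ → ℂ) : Prop where
  differentiableOn : DifferentiableOn ℂ L splitPlane
  hasSum : ∀ ξ : ℂ, ‖ξ‖ < 1 →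
    HasSum (fun j : ℕ => ξ ^ (j + 1) / ((((j + 1 : ℕ) : ℝ) ^ p : ℝ) : ℂ)) (L ξ)

/-- The polylogarithm `Li_p`, i.e. the analytic continuation of the series to the split plane. -/
def polylog (p : ℝ) : ℂ → ℂ := Classical.epsilon (IsPolylog p)

theorem isOpen_splitPlane : IsOpen splitPlane :=
  (Complex.isometry_ofReal.isClosedEmbedding.isClosedMap _ isClosed_Ici).isOpen_compl

theorem one_sub_mul_ne_zero {ξ : ℂ} (hξ : ξ ∈ splitPlane) {r : ℝ} (hr : r ∈ Icc (0 : ℝ) 1) :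
    1 - ξ * r ≠ 0 := by
  intro h
  rcases hr.1.eq_or_lt with h0 | h0
  · subst h0; simp at h
  · apply hξ
    refine ⟨r⁻¹, (one_le_inv₀ h0).2 hr.2, ?_⟩
    have hr' : (r : ℂ) ≠ 0 := by exact_mod_cast h0.ne'
    have : ξ * r = 1 := (sub_eq_zero.1 h).symm
    simp only [Complex.ofReal_inv]
    field_simp
    rw [mul_comm]; exact this.symm

theorem exists_lower_bound {ξ₀ : ℂ} (h₀ : ξ₀ ∈ splitPlane) :
    ∃ U ∈ 𝓝 ξ₀, ∃ c : ℝ, 0 < c ∧ U ⊆ splitPlane ∧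
      ∀ ξ ∈ U, ∀ r ∈ Icc (0 : ℝ) 1, c ≤ ‖1 - ξ * (r : ℂ)‖ := by
  obtain ⟨ε, hε, hsub⟩ :=
    Metric.nhds_basis_closedBall.mem_iff.1 (isOpen_splitPlane.mem_nhds h₀)
  have hK : IsCompact (Metric.closedBall ξ₀ ε ×ˢ Icc (0 : ℝ) 1) :=
    (isCompact_closedBall _ _).prod isCompact_Icc
  have hne : (Metric.closedBall ξ₀ ε ×ˢ Icc (0 : ℝ) 1).Nonempty :=
    ⟨(ξ₀, 0), Metric.mem_closedBall_self hε.le, by simp⟩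
  have hcont : ContinuousOn (fun q : ℂ × ℝ => ‖1 - q.1 * (q.2 : ℂ)‖)
      (Metric.closedBall ξ₀ ε ×ˢ Icc (0 : ℝ) 1) := by fun_prop
  obtain ⟨q, hq, hmin⟩ := hK.exists_isMinOn hne hcont
  refine ⟨_, Metric.closedBall_mem_nhds ξ₀ hε, ‖1 - q.1 * (q.2 : ℂ)‖, ?_, hsub, ?_⟩
  · exact norm_pos_iff.2 (one_sub_mul_ne_zero (hsub hq.1) hq.2)
  · intro ξ hξ r hr
    exact hmin (show (ξ, r) ∈ _ from ⟨hξ, hr⟩)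

theorem exp_neg_mem {t : ℝ} (ht : t ∈ Ioi (0 : ℝ)) : Real.exp (-t) ∈ Icc (0 : ℝ) 1 :=
  ⟨(Real.exp_pos _).le, Real.exp_le_one_iff.2 (by simpa using (mem_Ioi.1 ht).le)⟩

/-- The integral `∫₀^∞ t ^ (s - 1) e ^ {-t} / (1 - ξ e ^ {-t}) dt`. -/
def polylogIntegral (s : ℝ) (ξ : ℂ) : ℂ :=
  ∫ t in Ioi (0 : ℝ),
    ((Real.exp (-t) * t ^ (s - 1) : ℝ) : ℂ) * (1 - ξ * (Real.exp (-t) : ℝ))⁻¹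

theorem differentiableOn_polylogIntegral {s : ℝ} (hs : 0 < s) :
    DifferentiableOn ℂ (polylogIntegral s) splitPlane := by
  intro ξ₀ h₀
  obtain ⟨U, hU, c, hc, hUs, hb⟩ := exists_lower_bound h₀
  have hΓ := Real.GammaIntegral_convergent hs
  have hmeas : ∀ ξ : ℂ, AEStronglyMeasurable (fun t : ℝ =>
      ((Real.exp (-t) * t ^ (s - 1) : ℝ) : ℂ) * (1 - ξ * (Real.exp (-t) : ℝ))⁻¹)
      (volume.restrict (Ioi 0)) := fun ξ => by
    apply Measurable.aestronglyMeasurable; fun_prop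
  refine (HasDerivAt.differentiableAt (hasDerivAt_integral_of_dominated_loc_of_deriv_le
    (μ := volume.restrict (Ioi (0 : ℝ))) (s := U)
    (bound := fun t => (Real.exp (-t) * t ^ (s - 1)) * (c ^ 2)⁻¹)
    (F' := fun ξ t => ((Real.exp (-t) * t ^ (s - 1) : ℝ) : ℂ) *
      ((Real.exp (-t) : ℝ) / (1 - ξ * (Real.exp (-t) : ℝ)) ^ 2))
    hU (Eventually.of_forall hmeas) ?_ ?_ ?_ ?_ ?_).2).differentiableWithinAt
  · refine Integrable.mono' (hΓ.mul_const c⁻¹) (hmeas _) ?_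
    refine (ae_restrict_mem measurableSet_Ioi).mono fun t ht => ?_
    have hpos : 0 ≤ Real.exp (-t) * t ^ (s - 1) :=
      mul_nonneg (Real.exp_pos _).le (Real.rpow_nonneg (mem_Ioi.1 ht).le _)
    rw [norm_mul, norm_inv, Complex.norm_real, Real.norm_of_nonneg hpos]
    exact mul_le_mul_of_nonneg_left
      (inv_anti₀ hc (hb _ (mem_of_mem_nhds hU) _ (exp_neg_mem ht))) hpos
  · apply Measurable.aestronglyMeasurable; fun_prop
  · refine (ae_restrict_mem measurableSet_Ioi).mono fun t ht ξ hξ => ?_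
    have hpos : 0 ≤ Real.exp (-t) * t ^ (s - 1) :=
      mul_nonneg (Real.exp_pos _).le (Real.rpow_nonneg (mem_Ioi.1 ht).le _)
    rw [norm_mul, norm_div, norm_pow, Complex.norm_real, Complex.norm_real,
      Real.norm_of_nonneg hpos, Real.norm_of_nonneg (exp_neg_mem ht).1]
    refine mul_le_mul_of_nonneg_left ?_ hpos
    rw [div_eq_mul_inv]
    calc Real.exp (-t) * (‖1 - ξ * (Real.exp (-t) : ℝ)‖ ^ 2)⁻¹ ≤ 1 * (c ^ 2)⁻¹ := by
          refine mul_le_mul (exp_neg_mem ht).2 (inv_anti₀ (by positivity) ?_)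
            (by positivity) zero_le_one
          exact pow_le_pow_left₀ hc.le (hb _ hξ _ (exp_neg_mem ht)) 2
      _ = _ := one_mul _
  · exact hΓ.mul_const _
  · refine (ae_restrict_mem measurableSet_Ioi).mono fun t ht ξ hξ => ?_
    have hne := one_sub_mul_ne_zero (hUs hξ) (exp_neg_mem ht)
    have h1 : HasDerivAt (fun ξ : ℂ => 1 - ξ * (Real.exp (-t) : ℝ))
        (-(1 * ((Real.exp (-t) : ℝ) : ℂ))) ξ :=
      ((hasDerivAt_id ξ).mul_const _).const_sub 1
    have h2 := (h1.inv hne).const_mul ((Real.exp (-t) * t ^ (s - 1) : ℝ) : ℂ)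
    simpa using h2

theorem hasSum_polylogIntegral {s : ℝ} (hs : 0 < s) {ξ : ℂ} (hξ : ‖ξ‖ < 1) :
    HasSum (fun j : ℕ => ((Real.Gamma s : ℝ) : ℂ) * (ξ ^ j / ((((j + 1 : ℕ) : ℝ) ^ s : ℝ) : ℂ)))
      (polylogIntegral s ξ) := by
  have hint : ∀ j : ℕ, ∫ t in Ioi (0 : ℝ), t ^ (s - 1) * Real.exp (-(((j + 1 : ℕ) : ℝ) * t)) =
      Real.Gamma s / (((j + 1 : ℕ) : ℝ) ^ s) := fun j => by
    rw [Real.integral_rpow_mul_exp_neg_mul_Ioi hs (by positivity), one_div,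
      Real.inv_rpow (by positivity)]
    field_simp
  have hI : ∀ j : ℕ, IntegrableOn
      (fun t : ℝ => t ^ (s - 1) * Real.exp (-(((j + 1 : ℕ) : ℝ) * t))) (Ioi 0) := fun j => by
    by_contra h
    have h1 := hint j
    rw [integral_undef h] at h1
    have : 0 < Real.Gamma s / (((j + 1 : ℕ) : ℝ) ^ s) :=
      div_pos (Real.Gamma_pos_of_pos hs) (by positivity)
    linarith
  have hF : ∀ j : ℕ, ∀ t : ℝ, ((Real.exp (-t) * t ^ (s - 1) : ℝ) : ℂ) *
      (ξ * (Real.exp (-t) : ℝ)) ^ j =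
      ξ ^ j * ((t ^ (s - 1) * Real.exp (-(((j + 1 : ℕ) : ℝ) * t)) : ℝ) : ℂ) := fun j t => by
    have : Real.exp (-(((j + 1 : ℕ) : ℝ) * t)) = Real.exp (-t) ^ j * Real.exp (-t) := by
      rw [← pow_succ, ← Real.exp_nat_mul]; congr 1; ring
    rw [this]; push_cast; ring
  have key := hasSum_integral_of_summable_integral_norm
    (μ := volume.restrict (Ioi (0 : ℝ)))
    (F := fun (j : ℕ) (t : ℝ) => ξ ^ j *
      ((t ^ (s - 1) * Real.exp (-(((j + 1 : ℕ) : ℝ) * t)) : ℝ) : ℂ))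
    (fun j => (hI j).ofReal.const_mul _) ?_
  · have e1 : ∀ j : ℕ, ∫ t in Ioi (0 : ℝ), ξ ^ j *
        ((t ^ (s - 1) * Real.exp (-(((j + 1 : ℕ) : ℝ) * t)) : ℝ) : ℂ) =
        ((Real.Gamma s : ℝ) : ℂ) * (ξ ^ j / ((((j + 1 : ℕ) : ℝ) ^ s : ℝ) : ℂ)) := fun j => by
      rw [integral_const_mul, integral_complex_ofReal, hint j]
      push_cast; ring
    simp_rw [e1] at key
    refine (congrArg (HasSum _) ?_).mp key
    rw [polylogIntegral]
    symm
    refine setIntegral_congr_fun measurableSet_Ioi fun t ht => ?_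
    have hlt : ‖ξ * (Real.exp (-t) : ℝ)‖ < 1 := by
      rw [norm_mul, Complex.norm_real, Real.norm_of_nonneg (exp_neg_mem ht).1]
      exact lt_of_le_of_lt (mul_le_of_le_one_right (norm_nonneg _) (exp_neg_mem ht).2) hξ
    have hg := (hasSum_geometric_of_norm_lt_one hlt).mul_left
      ((Real.exp (-t) * t ^ (s - 1) : ℝ) : ℂ)
    simp_rw [hF] at hg
    exact hg.tsum_eq.symm
  · have e2 : ∀ j : ℕ, ∫ t in Ioi (0 : ℝ), ‖ξ ^ j *
        ((t ^ (s - 1) * Real.exp (-(((j + 1 : ℕ) : ℝ) * t)) : ℝ) : ℂ)‖ =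
        ‖ξ‖ ^ j * (Real.Gamma s / (((j + 1 : ℕ) : ℝ) ^ s)) := fun j => by
      rw [← hint j, ← integral_const_mul]
      refine setIntegral_congr_fun measurableSet_Ioi fun t ht => ?_
      have : 0 ≤ t ^ (s - 1) * Real.exp (-(((j + 1 : ℕ) : ℝ) * t)) :=
        mul_nonneg (Real.rpow_nonneg (mem_Ioi.1 ht).le _) (Real.exp_pos _).le
      simp only [norm_mul, norm_pow, Complex.norm_real]
      rw [← norm_mul, Real.norm_of_nonneg this]
    simp_rw [e2]
    refine Summable.of_nonneg_of_le (fun j => ?_) (fun j => ?_)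
      ((summable_geometric_of_lt_one (norm_nonneg ξ) hξ).mul_right (Real.Gamma s))
    · have := (Real.Gamma_pos_of_pos hs).le
      positivity
    · refine mul_le_mul_of_nonneg_left ?_ (by positivity)
      refine div_le_self (Real.Gamma_pos_of_pos hs).le ?_
      exact Real.one_le_rpow (by simp) hs.le

theorem exists_isPolylog {p : ℝ} (hp : -1 < p) : ∃ L, IsPolylog p L := by
  have hs : 0 < p + 1 := by linarith
  set M : ℂ → ℂ := fun ξ => ξ * ((((Real.Gamma (p + 1) : ℝ) : ℂ))⁻¹ * polylogIntegral (p + 1) ξ)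
    with hM
  have hMd : DifferentiableOn ℂ M splitPlane :=
    differentiableOn_id.mul ((differentiableOn_polylogIntegral hs).const_mul _)
  have hΓ : ((Real.Gamma (p + 1) : ℝ) : ℂ) ≠ 0 := by
    exact_mod_cast (Real.Gamma_pos_of_pos hs).ne'
  have hMs : ∀ ξ : ℂ, ‖ξ‖ < 1 →
      M ξ = ∑' j : ℕ, ξ ^ (j + 1) / ((((j + 1 : ℕ) : ℝ) ^ (p + 1) : ℝ) : ℂ) := fun ξ hξ => by
    have h := ((hasSum_polylogIntegral hs hξ).mul_left
      (((Real.Gamma (p + 1) : ℝ) : ℂ))⁻¹).mul_left ξ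
    rw [hM]
    refine (h.tsum_eq.symm).trans (tsum_congr fun j => ?_)
    rw [inv_mul_cancel_left₀ hΓ]; ring
  refine ⟨fun ξ => ξ * deriv M ξ, differentiableOn_id.mul (hMd.deriv isOpen_splitPlane), ?_⟩
  intro ξ hξ
  obtain ⟨r, hr, hr1⟩ := exists_between hξ
  have hr0 : 0 ≤ r := (norm_nonneg ξ).trans hr.le
  have hmem : ξ ∈ Metric.ball (0 : ℂ) r := by simpa using hr
  have key := Complex.hasSum_deriv_of_summable_norm (U := Metric.ball (0 : ℂ) r)
    (F := fun (j : ℕ) (w : ℂ) => w ^ (j + 1) / ((((j + 1 : ℕ) : ℝ) ^ (p + 1) : ℝ) : ℂ))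
    (u := fun j => r ^ j)
    (summable_geometric_of_lt_one hr0 hr1)
    (fun j => (differentiableOn_pow (j + 1)).div_const _) Metric.isOpen_ball ?_ hmem
  · have e : deriv (fun w : ℂ => ∑' j : ℕ,
        w ^ (j + 1) / ((((j + 1 : ℕ) : ℝ) ^ (p + 1) : ℝ) : ℂ)) ξ = deriv M ξ := by
      refine Filter.EventuallyEq.deriv_eq ?_
      filter_upwards [Metric.isOpen_ball.mem_nhds hmem] with w hw
      exact (hMs w (lt_trans (by simpa using hw) hr1)).symm
    rw [e] at key
    refine (congrArg (fun f => HasSum f (ξ * deriv M ξ)) (funext fun j => ?_)).mp (key.mul_left ξ)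
    have hj : (((j + 1 : ℕ) : ℝ)) ≠ 0 := by positivity
    have hj0 : (0 : ℝ) < ((j + 1 : ℕ) : ℝ) := by positivity
    have hjc : ((((j + 1 : ℕ) : ℝ) ^ p : ℝ) : ℂ) ≠ 0 := by
      exact_mod_cast (Real.rpow_pos_of_pos hj0 p).ne'
    rw [deriv_div_const, deriv_pow_field, Real.rpow_add_one hj]
    have hj' : ((j : ℂ) + 1) ≠ 0 := by exact_mod_cast hj
    push_cast at hjc ⊢
    field_simp
    ring
  · intro j w hw
    have hw' : ‖w‖ < r := by simpa using hw
    have h1 : (1 : ℝ) ≤ ((j + 1 : ℕ) : ℝ) ^ (p + 1) := Real.one_le_rpow (by simp) hs.le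
    rw [norm_div, norm_pow, Complex.norm_real, Real.norm_of_nonneg (by linarith)]
    refine (div_le_self (by positivity) h1).trans ?_
    refine (pow_le_pow_left₀ (norm_nonneg _) hw'.le _).trans ?_
    exact pow_le_pow_of_le_one hr0 hr1.le (Nat.le_succ j)

theorem isPolylog_polylog {p : ℝ} (hp : -1 < p) : IsPolylog p (polylog p) :=
  Classical.epsilon_spec (exists_isPolylog hp)

/-! ### The finite element space and the discrete Laplacian

All function spaces are complex, since the resolvents below have complex parameters. -/

/-- A bounded convex polygonal (polyhedral) domain: a nonempty open convex set whose closure is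
the convex hull of finitely many points. -/
structure IsConvexPolygonalDomain {d : ℕ} (Ω : Set (EuclideanSpace ℝ (Fin d))) : Prop where
  isOpen : IsOpen Ω
  convex : Convex ℝ Ω
  nonempty : Ω.Nonempty
  closure_eq : ∃ S : Finset (EuclideanSpace ℝ (Fin d)), closure Ω = convexHull ℝ (S : Set _)

/-- A conforming triangulation of `Ω` into `d`-simplexes, each given by its vertices. -/
structure Triangulation {d : ℕ} (Ω : Set (EuclideanSpace ℝ (Fin d))) where
  elements : Finset (Finset (EuclideanSpace ℝ (Fin d)))
  card_eq : ∀ s ∈ elements, s.card = d + 1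
  affineIndependent : ∀ s ∈ elements,
    AffineIndependent ℝ (fun x : s => (x : EuclideanSpace ℝ (Fin d)))
  conforming : ∀ s ∈ elements, ∀ t ∈ elements,
    convexHull ℝ (s : Set (EuclideanSpace ℝ (Fin d))) ∩ convexHull ℝ (t : Set _) =
      convexHull ℝ ((s : Set _) ∩ (t : Set _))
  cover : (⋃ s ∈ elements, convexHull ℝ (s : Set (EuclideanSpace ℝ (Fin d)))) = closure Ω

/-- `L²(Ω)`. -/
abbrev L2 {d : ℕ} (Ω : Set (EuclideanSpace ℝ (Fin d))) : Type :=
  Lp ℂ 2 (volume.restrict Ω)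

/-- `L²(Ω)ᵈ`. -/
abbrev L2Vec {d : ℕ} (Ω : Set (EuclideanSpace ℝ (Fin d))) : Type :=
  Lp (EuclideanSpace ℂ (Fin d)) 2 (volume.restrict Ω)

/-- `φ ∈ C_c^∞(Ω)`. -/
structure IsTest {d : ℕ} (Ω : Set (EuclideanSpace ℝ (Fin d)))
    (φ : EuclideanSpace ℝ (Fin d) → ℂ) : Prop where
  smooth : ContDiff ℝ ∞ φ
  hasCompactSupport : HasCompactSupport φ
  tsupport_subset : tsupport φ ⊆ Ω

/-- The classical gradient `(∂₁ φ, …, ∂_d φ)`. -/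
def classicalGrad {d : ℕ} (φ : EuclideanSpace ℝ (Fin d) → ℂ) (x : EuclideanSpace ℝ (Fin d)) :
    EuclideanSpace ℂ (Fin d) :=
  WithLp.toLp 2 fun i => fderiv ℝ φ x (EuclideanSpace.single i 1)

theorem IsTest.differentiable {d : ℕ} {Ω : Set (EuclideanSpace ℝ (Fin d))}
    {φ : EuclideanSpace ℝ (Fin d) → ℂ} (h : IsTest Ω φ) : Differentiable ℝ φ :=
  h.smooth.differentiable (by simp)

theorem IsTest.const_mul {d : ℕ} {Ω : Set (EuclideanSpace ℝ (Fin d))}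
    {φ : EuclideanSpace ℝ (Fin d) → ℂ} (h : IsTest Ω φ) (a : ℂ) : IsTest Ω fun x => a * φ x :=
  ⟨contDiff_const.mul h.smooth, h.hasCompactSupport.mul_left,
    (tsupport_mul_subset_right (f := fun _ => a)).trans h.tsupport_subset⟩

theorem classicalGrad_const_mul {d : ℕ} {Ω : Set (EuclideanSpace ℝ (Fin d))}
    {φ : EuclideanSpace ℝ (Fin d) → ℂ} (h : IsTest Ω φ) (a : ℂ) (x : EuclideanSpace ℝ (Fin d)) :
    classicalGrad (fun x => a * φ x) x = a • classicalGrad φ x := by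
  ext i
  simp only [classicalGrad, PiLp.smul_apply]
  rw [fderiv_const_mul (h.differentiable x)]
  rfl

/-- The graph `{(φ, ∇φ) : φ ∈ C_c^∞(Ω)}` in `L²(Ω) × L²(Ω)ᵈ`. -/
def testGraph {d : ℕ} (Ω : Set (EuclideanSpace ℝ (Fin d))) : Submodule ℂ (L2 Ω × L2Vec Ω) where
  carrier := {p | ∃ φ, IsTest Ω φ ∧ p.1 =ᵐ[volume.restrict Ω] φ ∧
    p.2 =ᵐ[volume.restrict Ω] classicalGrad φ}
  zero_mem' := by
    refine ⟨fun _ => 0, ⟨contDiff_const, HasCompactSupport.zero, ?_⟩, Lp.coeFn_zero _ _ _, ?_⟩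
    · simp [tsupport]
    · filter_upwards [Lp.coeFn_zero (EuclideanSpace ℂ (Fin d)) 2 (volume.restrict Ω)] with x hx
      refine hx.trans ?_
      ext i
      simp [classicalGrad]
  add_mem' := by
    rintro p q ⟨φ, hφ, h1, h2⟩ ⟨χ, hχ, h3, h4⟩
    refine ⟨fun x => φ x + χ x, ⟨hφ.smooth.add hχ.smooth,
      hφ.hasCompactSupport.add hχ.hasCompactSupport,
      (tsupport_add φ χ).trans (union_subset hφ.tsupport_subset hχ.tsupport_subset)⟩, ?_, ?_⟩
    · filter_upwards [Lp.coeFn_add p.1 q.1, h1, h3] with x hx e1 e2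
      simp only [Prod.fst_add, hx, Pi.add_apply, e1, e2]
    · filter_upwards [Lp.coeFn_add p.2 q.2, h2, h4] with x hx e1 e2
      simp only [Prod.snd_add, hx, Pi.add_apply, e1, e2]
      ext i
      simp only [classicalGrad, PiLp.add_apply]
      rw [fderiv_fun_add (hφ.differentiable x) (hχ.differentiable x)]
      simp
  smul_mem' := by
    rintro a ⟨v, g⟩ ⟨φ, hφ, h1, h2⟩
    refine ⟨fun x => a * φ x, hφ.const_mul a, ?_, ?_⟩
    · exact (Lp.coeFn_smul a v).trans (h1.mono fun x e => congrArg (a * ·) e)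
    · refine (Lp.coeFn_smul a g).trans (h2.mono fun x e => ?_)
      rw [classicalGrad_const_mul hφ a x]
      exact congrArg (a • ·) e

/-- The weak gradient with domain `H¹₀(Ω)`: the closure in `L²(Ω) × L²(Ω)ᵈ` of the gradient on
`C_c^∞(Ω)`. Thus `H¹₀(Ω)` is the closure of `C_c^∞(Ω)` in the `H¹`-norm. -/
def weakGrad {d : ℕ} (Ω : Set (EuclideanSpace ℝ (Fin d))) : L2 Ω →ₗ.[ℂ] L2Vec Ω :=
  (testGraph Ω).topologicalClosure.toLinearPMap

/-- `H¹₀(Ω)` as a subspace of `L²(Ω)`. -/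
def H10 {d : ℕ} (Ω : Set (EuclideanSpace ℝ (Fin d))) : Submodule ℂ (L2 Ω) := (weakGrad Ω).domain

/-- The gradient is closable, so that `weakGrad` is well defined. -/
theorem testGraph_closure_single_valued {d : ℕ} {Ω : Set (EuclideanSpace ℝ (Fin d))}
    (hΩ : IsOpen Ω) (p : L2 Ω × L2Vec Ω) (hp : p ∈ (testGraph Ω).topologicalClosure)
    (h0 : p.1 = 0) : p.2 = 0 := by
  have key : ∀ (ψ : EuclideanSpace ℝ (Fin d) → ℝ), ContDiff ℝ ∞ ψ → HasCompactSupport ψ →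
      tsupport ψ ⊆ Ω → ∀ i, ∫ x, ψ x • (p.2 x i) ∂(volume.restrict Ω) = 0 := by
    intro ψ hψ hc hs i
    have hψd : Differentiable ℝ ψ := hψ.differentiable (by simp)
    have hψ' : Continuous fun x => fderiv ℝ ψ x (EuclideanSpace.single i 1) :=
      (hψ.continuous_fderiv (by simp)).clm_apply continuous_const
    have hc' : HasCompactSupport fun x => fderiv ℝ ψ x (EuclideanSpace.single i (1 : ℝ)) :=
      hc.fderiv_apply (𝕜 := ℝ) _
    have m1 : MemLp (fun x => EuclideanSpace.single i ((ψ x : ℝ) : ℂ)) 2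
        (volume.restrict Ω) := by
      refine (Continuous.memLp_of_hasCompactSupport (μ := volume) ?_ ?_).restrict Ω
      · have := hψ.continuous
        have h2 : (fun x => EuclideanSpace.single i ((ψ x : ℝ) : ℂ)) =
            fun x => ((ψ x : ℝ) : ℂ) • EuclideanSpace.single i (1 : ℂ) := by
          funext x; ext j; by_cases h : j = i <;> simp [h]
        rw [h2]; fun_prop
      · exact hc.comp_left (g := fun r : ℝ => EuclideanSpace.single i (r : ℂ)) (by simp)
    have m2 : MemLp (fun x => ((fderiv ℝ ψ x (EuclideanSpace.single i 1) : ℝ) : ℂ)) 2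
        (volume.restrict Ω) := by
      refine (Continuous.memLp_of_hasCompactSupport (μ := volume) ?_ ?_).restrict Ω
      · fun_prop
      · exact hc'.comp_left (g := fun r : ℝ => (r : ℂ)) (by simp)
    set F : L2 Ω × L2Vec Ω → ℂ := fun q => inner ℂ (m1.toLp _) q.2 + inner ℂ (m2.toLp _) q.1
      with hF
    have hFc : Continuous F := by
      rw [hF]; fun_prop
    have hFq : ∀ q : L2 Ω × L2Vec Ω, F q = (∫ x, ψ x • (q.2 x i) ∂(volume.restrict Ω)) +
        ∫ x, (fderiv ℝ ψ x (EuclideanSpace.single i 1)) • q.1 x ∂(volume.restrict Ω) := by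
      intro q
      simp only [hF, L2.inner_def]
      congr 1
      · refine integral_congr_ae ?_
        filter_upwards [m1.coeFn_toLp] with x hx
        rw [hx]
        simp [EuclideanSpace.inner_single_left]
      · refine integral_congr_ae ?_
        filter_upwards [m2.coeFn_toLp] with x hx
        rw [hx]
        simp [mul_comm]
    have hFp : F p = 0 := by
      have hsub : closure ((testGraph Ω : Submodule ℂ _) : Set (L2 Ω × L2Vec Ω)) ⊆ F ⁻¹' {0} := by
        refine closure_minimal ?_ (isClosed_singleton.preimage hFc)
        rintro q ⟨φ, hφ, e1, e2⟩
        rw [mem_preimage, mem_singleton_iff, hFq]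
        have i1 : ∫ x, ψ x • (q.2 x i) ∂(volume.restrict Ω) =
            ∫ x, ψ x • fderiv ℝ φ x (EuclideanSpace.single i 1) := by
          rw [← setIntegral_eq_integral_of_forall_compl_eq_zero (s := Ω)
            (f := fun x => ψ x • fderiv ℝ φ x (EuclideanSpace.single i 1))]
          · refine integral_congr_ae ?_
            filter_upwards [e2] with x hx
            rw [hx]; rfl
          · intro x hx
            rw [image_eq_zero_of_notMem_tsupport (fun h => hx (hs h)), zero_smul]
        have i2 : ∫ x, (fderiv ℝ ψ x (EuclideanSpace.single i 1)) • q.1 x ∂(volume.restrict Ω) =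
            ∫ x, (fderiv ℝ ψ x (EuclideanSpace.single i 1)) • φ x := by
          rw [← setIntegral_eq_integral_of_forall_compl_eq_zero (s := Ω)
            (f := fun x => (fderiv ℝ ψ x (EuclideanSpace.single i 1)) • φ x)]
          · refine integral_congr_ae ?_
            filter_upwards [e1] with x hx
            rw [hx]
          · intro x hx
            rw [image_eq_zero_of_notMem_tsupport (fun h => hx (hφ.tsupport_subset h)), smul_zero]
        have hφ' : Continuous fun x => fderiv ℝ φ x (EuclideanSpace.single i (1 : ℝ)) :=
          (hφ.smooth.continuous_fderiv (by simp)).clm_apply continuous_const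
        rw [i1, i2, integral_smul_fderiv_eq_neg_fderiv_smul_of_integrable
          (f := ψ) (g := φ) (v := EuclideanSpace.single i 1)]
        · simp
        · exact (hψ'.smul hφ.smooth.continuous).integrable_of_hasCompactSupport hc'.smul_right
        · exact (hψ.continuous.smul hφ').integrable_of_hasCompactSupport hc.smul_right
        · exact (hψ.continuous.smul hφ.smooth.continuous).integrable_of_hasCompactSupport
            hc.smul_right
        · exact fun x _ => hψd x
        · exact fun x _ => hφ.differentiable x
      exact hsub hp
    rw [hFq] at hFp
    have hz : ∫ x, (fderiv ℝ ψ x (EuclideanSpace.single i 1)) • p.1 x ∂(volume.restrict Ω) = 0 := by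
      rw [h0]
      refine integral_eq_zero_of_ae ?_
      filter_upwards [Lp.coeFn_zero ℂ 2 (volume.restrict Ω)] with x hx
      rw [hx]; simp
    rwa [hz, add_zero] at hFp
  have hcoord : ∀ i, ∀ᵐ x ∂(volume.restrict Ω), p.2 x i = 0 := by
    intro i
    have hmem : MemLp (fun x => p.2 x i) 2 (volume.restrict Ω) :=
      (EuclideanSpace.proj (𝕜 := ℂ) i).comp_memLp' (Lp.memLp p.2)
    have hloc : LocallyIntegrable (fun x => p.2 x i) (volume.restrict Ω) :=
      hmem.locallyIntegrable (by norm_num)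
    have := hΩ.ae_eq_zero_of_integral_contDiff_smul_eq_zero (μ := volume.restrict Ω)
      (hloc.locallyIntegrableOn Ω) (fun ψ h1 h2 h3 => key ψ h1 h2 h3 i)
    filter_upwards [this, ae_restrict_mem hΩ.measurableSet] with x hx hxΩ using hx hxΩ
  refine Lp.ext ?_
  filter_upwards [ae_all_iff.2 hcoord, Lp.coeFn_zero (EuclideanSpace ℂ (Fin d)) 2
    (volume.restrict Ω)] with x hx h0x
  rw [h0x]
  ext i
  simpa using hx i

namespace Triangulation

variable {d : ℕ} {Ω : Set (EuclideanSpace ℝ (Fin d))}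

/-- The finite element space `X_h`: the functions in `H¹₀(Ω)` that agree with an affine function
on every element of the triangulation. It carries the norm and inner product of `L²(Ω)`. -/
def feSpace (T : Triangulation Ω) : Submodule ℂ (L2 Ω) where
  carrier := {v | v ∈ H10 Ω ∧ ∀ s ∈ T.elements, ∃ L : EuclideanSpace ℝ (Fin d) →ᵃ[ℝ] ℂ,
    ∀ᵐ x ∂(volume.restrict Ω), x ∈ convexHull ℝ (s : Set (EuclideanSpace ℝ (Fin d))) → v x = L x}
  zero_mem' := ⟨zero_mem _, fun s _ => ⟨0, by
    filter_upwards [Lp.coeFn_zero ℂ 2 (volume.restrict Ω)] with x hx _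
    rw [hx]; rfl⟩⟩
  add_mem' := by
    rintro v w ⟨hv, hv'⟩ ⟨hw, hw'⟩
    refine ⟨add_mem hv hw, fun s hs => ?_⟩
    obtain ⟨L, hL⟩ := hv' s hs
    obtain ⟨M, hM⟩ := hw' s hs
    refine ⟨L + M, ?_⟩
    filter_upwards [Lp.coeFn_add v w, hL, hM] with x hx h1 h2 hxs
    exact hx.trans (by rw [Pi.add_apply, h1 hxs, h2 hxs]; rfl)
  smul_mem' := by
    rintro a v ⟨hv, hv'⟩
    refine ⟨Submodule.smul_mem _ a hv, fun s hs => ?_⟩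
    obtain ⟨L, hL⟩ := hv' s hs
    refine ⟨a • L, ?_⟩
    filter_upwards [Lp.coeFn_smul a v, hL] with x hx h1 hxs
    exact hx.trans (by rw [Pi.smul_apply, h1 hxs]; rfl)

theorem feSpace_le_H10 (T : Triangulation Ω) : T.feSpace ≤ H10 Ω := fun _ hv => hv.1

instance finiteDimensional_feSpace (T : Triangulation Ω) : FiniteDimensional ℂ T.feSpace := by
  have hfd : FiniteDimensional ℂ (EuclideanSpace ℝ (Fin d) →ᵃ[ℝ] ℂ) := by
    have : Module.Finite ℂ (EuclideanSpace ℝ (Fin d) →ₗ[ℝ] ℂ) :=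
      Module.Finite.of_restrictScalars_finite ℝ ℂ _
    exact Module.Finite.equiv (AffineMap.toConstProdLinearMap ℂ
      (k := ℝ) (V1 := EuclideanSpace ℝ (Fin d)) (V2 := ℂ)).symm
  let P : Submodule ℂ ((T.elements → (EuclideanSpace ℝ (Fin d) →ᵃ[ℝ] ℂ)) × T.feSpace) :=
    { carrier := {q | ∀ s : T.elements, ∀ᵐ x ∂(volume.restrict Ω),
        x ∈ convexHull ℝ (s.1 : Set (EuclideanSpace ℝ (Fin d))) →
          (q.2 : L2 Ω) x = q.1 s x}
      zero_mem' := fun s => by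
        filter_upwards [Lp.coeFn_zero ℂ 2 (volume.restrict Ω)] with x hx _
        exact hx
      add_mem' := fun {q r} hq hr s => by
        filter_upwards [Lp.coeFn_add (q.2 : L2 Ω) (r.2 : L2 Ω), hq s, hr s] with x hx h1 h2 hxs
        exact hx.trans (by rw [Pi.add_apply, h1 hxs, h2 hxs]; rfl)
      smul_mem' := fun a q hq s => by
        filter_upwards [Lp.coeFn_smul a (q.2 : L2 Ω), hq s] with x hx h1 hxs
        exact hx.trans (by rw [Pi.smul_apply, h1 hxs]; rfl) }
  have hinj : Function.Injective ((LinearMap.fst ℂ _ _).comp P.subtype) := by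
    rw [← LinearMap.ker_eq_bot, LinearMap.ker_eq_bot']
    rintro ⟨⟨L, v⟩, hq⟩ h
    have hL : L = 0 := h
    subst hL
    have hv : v = 0 := by
      refine Subtype.ext (Lp.ext ?_)
      have hall := ae_all_iff.2 hq
      have hcl : ∀ᵐ x ∂(volume.restrict Ω), x ∈ closure Ω :=
        ae_mono (Measure.restrict_mono subset_closure le_rfl)
          (ae_restrict_mem isClosed_closure.measurableSet)
      filter_upwards [hall, hcl, Lp.coeFn_zero ℂ 2 (volume.restrict Ω)] with x hx hxc h0
      rw [← T.cover] at hxc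
      obtain ⟨s, hs, hxs⟩ := mem_iUnion₂.1 hxc
      exact (hx ⟨s, hs⟩ hxs).trans h0.symm
    subst hv
    rfl
  have hPfd : FiniteDimensional ℂ P := FiniteDimensional.of_injective _ hinj
  refine Module.Finite.of_surjective ((LinearMap.snd ℂ _ _).comp P.subtype) ?_
  intro v
  choose L hL using v.2.2
  exact ⟨⟨⟨fun s => L s s.2, v⟩, fun s => hL s s.2⟩, rfl⟩

/-- The gradient on the finite element space. -/
def feGrad (T : Triangulation Ω) : T.feSpace →ₗ[ℂ] L2Vec Ω :=
  (weakGrad Ω).toFun ∘ₗ Submodule.inclusion T.feSpace_le_H10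

instance completeSpace_feSpace (T : Triangulation Ω) : CompleteSpace T.feSpace :=
  FiniteDimensional.complete ℂ _

/-- The operator `A_h = -Δ_h` on `X_h`, given by `(A_h φ, χ) = (∇φ, ∇χ)` for `φ, χ ∈ X_h`. -/
def negLaplacian (T : Triangulation Ω) : T.feSpace →L[ℂ] T.feSpace :=
  ContinuousLinearMap.adjoint (LinearMap.toContinuousLinearMap T.feGrad) ∘L
    LinearMap.toContinuousLinearMap T.feGrad

theorem inner_negLaplacian (T : Triangulation Ω) (φ χ : T.feSpace) :
    inner ℂ (T.negLaplacian φ) χ = inner ℂ (T.feGrad φ) (T.feGrad χ) := by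
  simp [negLaplacian, ContinuousLinearMap.adjoint_inner_left]

end Triangulation

/-! ### The contour and the kernels -/

/-- The contour `Γ_{θ,δ}`. -/
def contour (θ δ : ℝ) : Set ℂ :=
  {z | ‖z‖ = δ ∧ |z.arg| ≤ θ} ∪
    {z | ∃ ρ : ℝ, δ ≤ ρ ∧ (z = ρ * Complex.exp (θ * Complex.I) ∨
      z = ρ * Complex.exp (-(θ * Complex.I)))}

/-- The truncated contour `Γ_τ`. -/
def truncatedContour (θ δ τ : ℝ) : Set ℂ := {z ∈ contour θ δ | |z.im| ≤ Real.pi / τ}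

/-- `ψ(w) = (e ^ w - 1) / Γ(2 - α) * Li_{α - 1}(e ^ {-w})`. -/
def psi (α : ℝ) (w : ℂ) : ℂ :=
  (Complex.exp w - 1) / (Real.Gamma (2 - α) : ℝ) * polylog (α - 1) (Complex.exp (-w))

/-- `χ₁(z) = τ ^ {-α} (1 - e ^ {-zτ}) ψ(zτ)`. -/
def chi1 (α τ : ℝ) (z : ℂ) : ℂ :=
  (1 - Complex.exp (-(z * τ))) / ((τ ^ α : ℝ) : ℂ) * psi α (z * τ)

variable {X : Type*} [NormedAddCommGroup X] [NormedSpace ℂ X]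

/-- `K₁(z) = -z⁻¹ (z ^ α + A)⁻¹ A`. -/
def kernelOne (A : X →L[ℂ] X) (α : ℝ) (z : ℂ) : X →L[ℂ] X :=
  -(z⁻¹ • (Ring.inverse (z ^ (α : ℂ) • (1 : X →L[ℂ] X) + A) * A))

/-- `K₂(z) = -τ / (1 - e ^ {-zτ}) (χ₁(z) + A)⁻¹ A`. -/
def kernelTwo (A : X →L[ℂ] X) (α τ : ℝ) (z : ℂ) : X →L[ℂ] X :=
  -(((τ : ℂ) / (1 - Complex.exp (-(z * τ)))) •
    (Ring.inverse (chi1 α τ z • (1 : X →L[ℂ] X) + A) * A))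

end L1Scheme

end

namespace L1Scheme

/-! ### Functions of a positive operator -/

section Operators

variable {E : Type*} [NormedAddCommGroup E] [InnerProductSpace ℂ E] [CompleteSpace E]

/-! The discrete Laplacian has the form `G† G`, so it is a positive operator, and the continuous
functional calculus bounds a function of it by the supremum over its spectrum in `[0, ∞)`. A scalar
bound valid for every `t ≥ 0` therefore suffices, and its constant cannot depend on the domain or
the mesh.

Put `w = zτ`, `W = w ^ α`, `G = symbol α w`. The two resolvent symbols are `W` and `G` divided by `τ
^ α`, so replacing `t` by `τ ^ α t` pulls one factor `τ` out of the difference. It remains to bound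
`w⁻¹ t / (W + t) - (1 - e ^ {-w})⁻¹ t / (G + t)` in the bounded part of the slit plane swept out by
the scaled contour. `norm_symbol_difference_le` does this from three inputs: boundedness of `w⁻¹ -
(1 - e ^ {-w})⁻¹`, the consistency bound `|G - W| ≤ C |w| |W|`, and lower bounds for `|W + t|` and
`|G + t|`.

Consistency (`exists_norm_symbol_sub_cpow_le`) comes from writing the polylogarithm at `e ^ {-w}` as
an integral of `t ^ (α - 1)` against `1 / (4 sinh² ((t + w) / 2))`. Replacing this kernel by `1 / (t
+ w) ²` gives exactly a multiple of `w ^ (α - 2)`, and the error is bounded because the double poles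
cancel.

For the lower bounds (`exists_symbol_sector`), `W` stays in a sector away from the negative axis.
Near the origin `G` inherits this from consistency. Elsewhere `Re G > 0`: on the closed right half
plane this follows from the concavity of `x ↦ x ^ (1 - α)`, which makes the power series
coefficients of `1 - Γ(2 - α) G` nonnegative with partial sums at most one, and compactness extends
it to a thin strip on the left. The width of that strip determines `θ₀`. -/

theorem exists_nonneg_of_mem_spectrum {A : E →L[ℂ] E} (hA : A.IsPositive) {x : ℂ}
    (hx : x ∈ spectrum ℂ A) : ∃ t : ℝ, 0 ≤ t ∧ x = t := by
  have hre : x = x.re := hA.isSelfAdjoint.mem_spectrum_eq_re hx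
  refine ⟨x.re, ?_, hre⟩
  rw [hre] at hx
  exact spectrum_nonneg_of_nonneg (ContinuousLinearMap.nonneg_iff_isPositive A |>.2 hA)
    ((spectrum.algebraMap_mem_iff ℂ).1 hx)

theorem cfc_const_add_id_eq {A : E →L[ℂ] E} (hA : A.IsPositive) (μ : ℂ) :
    cfc (fun x : ℂ => μ + x) A = μ • (1 : E →L[ℂ] E) + A := by
  have hn : IsStarNormal A := hA.isSelfAdjoint.isStarNormal
  rw [cfc_const_add μ (fun x : ℂ => x) A, cfc_id' ℂ A, Algebra.algebraMap_eq_smul_one]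

theorem continuousOn_inv_const_add {A : E →L[ℂ] E} (hA : A.IsPositive) {μ : ℂ}
    (hμ : ∀ t : ℝ, 0 ≤ t → μ + t ≠ 0) :
    ContinuousOn (fun x : ℂ => (μ + x)⁻¹) (spectrum ℂ A) := by
  refine ContinuousOn.inv₀ (by fun_prop) fun x hx => ?_
  obtain ⟨t, ht, rfl⟩ := exists_nonneg_of_mem_spectrum hA hx
  exact hμ t ht

theorem cfc_resolvent_mul {A : E →L[ℂ] E} (hA : A.IsPositive) {μ : ℂ}
    (hμ : ∀ t : ℝ, 0 ≤ t → μ + t ≠ 0) :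
    IsUnit (μ • (1 : E →L[ℂ] E) + A) ∧
      cfc (fun x : ℂ => (μ + x)⁻¹ * x) A = Ring.inverse (μ • (1 : E →L[ℂ] E) + A) * A := by
  have hn : IsStarNormal A := hA.isSelfAdjoint.isStarNormal
  have h0 : ∀ x ∈ spectrum ℂ A, μ + x ≠ 0 := fun x hx => by
    obtain ⟨t, ht, rfl⟩ := exists_nonneg_of_mem_spectrum hA hx
    exact hμ t ht
  have hi := continuousOn_inv_const_add hA hμ
  refine ⟨?_, ?_⟩
  · rw [← cfc_const_add_id_eq hA]
    exact (isUnit_cfc_iff (fun x : ℂ => μ + x) A).2 h0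
  · rw [cfc_mul (fun x : ℂ => (μ + x)⁻¹) (fun x => x) A hi, cfc_id' ℂ A,
      cfc_inv (fun x : ℂ => μ + x) A h0, cfc_const_add_id_eq hA]

/-- Both operators are functions of the same `A`, so their difference is a single function of `A`,
bounded in norm by its supremum on the spectrum. -/
theorem norm_resolvent_difference_le {A : E →L[ℂ] E} (hA : A.IsPositive) {μ ν p q : ℂ} {C : ℝ}
    (hμ : ∀ t : ℝ, 0 ≤ t → μ + t ≠ 0) (hν : ∀ t : ℝ, 0 ≤ t → ν + t ≠ 0)
    (hC : ∀ t : ℝ, 0 ≤ t → ‖p * ((μ + t)⁻¹ * t) - q * ((ν + t)⁻¹ * t)‖ ≤ C) :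
    ‖p • (Ring.inverse (μ • (1 : E →L[ℂ] E) + A) * A) -
      q • (Ring.inverse (ν • (1 : E →L[ℂ] E) + A) * A)‖ ≤ C := by
  have hn : IsStarNormal A := hA.isSelfAdjoint.isStarNormal
  have h1 : ContinuousOn (fun x : ℂ => (μ + x)⁻¹ * x) (spectrum ℂ A) :=
    (continuousOn_inv_const_add hA hμ).mul continuousOn_id
  have h2 : ContinuousOn (fun x : ℂ => (ν + x)⁻¹ * x) (spectrum ℂ A) :=
    (continuousOn_inv_const_add hA hν).mul continuousOn_id
  rw [← (cfc_resolvent_mul hA hμ).2, ← (cfc_resolvent_mul hA hν).2, ← cfc_const_mul p _ A h1,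
    ← cfc_const_mul q _ A h2, ← cfc_sub (fun x => p * ((μ + x)⁻¹ * x)) (fun x => q * ((ν + x)⁻¹ * x)) A
      (continuousOn_const.mul h1) (continuousOn_const.mul h2)]
  refine norm_cfc_le ((norm_nonneg _).trans (hC 0 le_rfl)) fun x hx => ?_
  obtain ⟨t, ht, rfl⟩ := exists_nonneg_of_mem_spectrum hA hx
  exact hC t ht

end Operators

/-! ### Scalar estimates -/

/-- With `k = cos (φ / 2)`, the law of cosines gives the squared modulus as `k² (r + t)² + (1 - k²)
(r - t)²`, and the second term is nonnegative. -/
theorem norm_polar_add_ofReal_ge (φ r t : ℝ) :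
    Real.cos (φ / 2) * (r + t) ≤ ‖r * (Real.cos φ + Real.sin φ * Complex.I) + (t : ℂ)‖ := by
  have h2 : Real.cos φ = 2 * Real.cos (φ / 2) ^ 2 - 1 := by
    rw [← Real.cos_two_mul]; congr 1; ring
  have hw : r * (Real.cos φ + Real.sin φ * Complex.I) + (t : ℂ) =
      ((r * Real.cos φ + t : ℝ) : ℂ) + (r * Real.sin φ : ℝ) * Complex.I := by
    push_cast; ring
  refine le_of_sq_le_sq ?_ (norm_nonneg _)
  rw [hw, Complex.sq_norm, Complex.normSq_add_mul_I]
  have hs : Real.sin φ ^ 2 = 1 - Real.cos φ ^ 2 := by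
    rw [← Real.sin_sq_add_cos_sq φ]; ring
  have hk1 : Real.cos φ ≤ 1 := Real.cos_le_one _
  have e : (r * Real.cos φ + t) ^ 2 + (r * Real.sin φ) ^ 2 =
      r ^ 2 + t ^ 2 + 2 * r * t * Real.cos φ := by
    rw [mul_pow r (Real.sin φ), hs]; ring
  rw [e]
  set k := Real.cos (φ / 2)
  have h4 : 0 ≤ (1 - k ^ 2) * (r - t) ^ 2 := mul_nonneg (by linarith) (sq_nonneg _)
  rw [h2]
  linarith

theorem norm_add_ofReal_ge (w : ℂ) (t : ℝ) :
    Real.cos (w.arg / 2) * (‖w‖ + t) ≤ ‖w + t‖ := by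
  have h := norm_polar_add_ofReal_ge w.arg ‖w‖ t
  push_cast at h
  rwa [Complex.norm_mul_cos_add_sin_mul_I] at h

/-- The power has polar angle `α arg w`, at most `πα < π` in size, so its half-angle cosine is
bounded below independently of `w`. -/
theorem norm_cpow_add_ofReal_ge {α : ℝ} (hα0 : 0 < α) (hα1 : α < 1) (w : ℂ) {t : ℝ}
    (ht : 0 ≤ t) : Real.cos (Real.pi * α / 2) * (‖w‖ ^ α + t) ≤ ‖w ^ (α : ℂ) + t‖ := by
  have hπ := Real.pi_pos
  have hr : 0 ≤ ‖w‖ ^ α := Real.rpow_nonneg (norm_nonneg _) _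
  rw [Complex.cpow_ofReal]
  refine le_trans ?_ (norm_polar_add_ofReal_ge (w.arg * α) _ t)
  refine mul_le_mul_of_nonneg_right ?_ (add_nonneg hr ht)
  rw [← Real.cos_abs (w.arg * α / 2)]
  refine Real.cos_le_cos_of_nonneg_of_le_pi (abs_nonneg _) (by nlinarith) ?_
  rw [abs_div, abs_mul, abs_of_pos hα0, abs_two]
  have := mul_le_mul_of_nonneg_right (Complex.abs_arg_le_pi w) hα0.le
  linarith

theorem norm_symbol_difference_le {w W G q : ℂ} {s C₁ C₂ t : ℝ} (hs : 0 < s) (hw : w ≠ 0)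
    (hW0 : W ≠ 0) (ht : 0 ≤ t) (hW : s * ‖W‖ ≤ ‖W + t‖) (hG : s * t ≤ ‖G + t‖)
    (hG0 : G + t ≠ 0) (hGW : ‖G - W‖ ≤ C₁ * (‖w‖ * ‖W‖)) (hq : ‖w⁻¹ - q‖ ≤ C₂) :
    ‖w⁻¹ * ((W + t)⁻¹ * t) - q * ((G + t)⁻¹ * t)‖ ≤ C₂ / s + C₁ / s ^ 2 := by
  have hWn : 0 < ‖W‖ := norm_pos_iff.2 hW0
  have hwn : 0 < ‖w‖ := norm_pos_iff.2 hw
  have hWt : 0 < ‖W + t‖ := lt_of_lt_of_le (by positivity) hW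
  have hWt0 : W + t ≠ 0 := norm_pos_iff.1 hWt
  have hGt : 0 < ‖G + t‖ := norm_pos_iff.2 hG0
  -- The first term carries the error of the prefactor. In the second, the factors `|w|` and `|W|`
  -- of the consistency bound cancel `w⁻¹` and `W + t` respectively.
  have e : w⁻¹ * ((W + t)⁻¹ * t) - q * ((G + t)⁻¹ * t) =
      (w⁻¹ - q) * (t / (G + t)) + w⁻¹ * ((t / (G + t)) * ((G - W) / (W + t))) := by
    field_simp
    ring
  have h1 : ‖(t : ℂ) / (G + t)‖ ≤ 1 / s := by
    rw [norm_div, Complex.norm_of_nonneg ht, div_le_div_iff₀ hGt hs]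
    linarith
  have h2 : ‖(G - W) / (W + t)‖ ≤ C₁ * ‖w‖ / s := by
    have hC : 0 ≤ C₁ * ‖w‖ := by
      have := (norm_nonneg _).trans hGW
      rw [← mul_assoc] at this
      exact nonneg_of_mul_nonneg_left this hWn
    rw [norm_div, div_le_div_iff₀ hWt hs]
    calc ‖G - W‖ * s ≤ C₁ * (‖w‖ * ‖W‖) * s := by gcongr
      _ = (C₁ * ‖w‖) * (s * ‖W‖) := by ring
      _ ≤ _ := by gcongr
  rw [e]
  refine (norm_add_le _ _).trans (add_le_add ?_ ?_)
  · rw [norm_mul, div_eq_mul_one_div C₂]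
    exact mul_le_mul hq h1 (norm_nonneg _) ((norm_nonneg _).trans hq)
  · rw [norm_mul, norm_mul, norm_inv]
    calc ‖w‖⁻¹ * (‖(t : ℂ) / (G + t)‖ * ‖(G - W) / (W + t)‖)
        ≤ ‖w‖⁻¹ * (1 / s * (C₁ * ‖w‖ / s)) := by gcongr
      _ = C₁ / s ^ 2 := by field_simp

/-! ### Integral formulas -/

/-- Differentiation under the integral, stated once for the polylogarithm kernel (`q = 1`) and the
Stieltjes kernel (`q = t + 1`). Differentiating costs a factor `2 b / (a + ξ b)`, which `|b| ≤ q`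
keeps bounded, so `m / q²` still dominates. -/
theorem differentiableOn_integral_inv_sq {m q : ℝ → ℝ} {a b : ℝ → ℂ} {S : Set ℂ}
    (hm : Measurable m) (ha : Measurable a) (hb : Measurable b)
    (hm0 : ∀ t, 0 < t → 0 ≤ m t) (hq0 : ∀ t, 0 < t → 0 < q t) (hbq : ∀ t, 0 < t → ‖b t‖ ≤ q t)
    (hint : IntegrableOn (fun t => m t / q t ^ 2) (Ioi 0))
    (hS : ∀ ξ₀ ∈ S, ∃ U ∈ 𝓝 ξ₀, ∃ c : ℝ, 0 < c ∧
      ∀ ξ ∈ U, ∀ t : ℝ, 0 < t → c * q t ≤ ‖a t + ξ * b t‖) :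
    DifferentiableOn ℂ (fun ξ => ∫ t in Ioi (0 : ℝ), (m t : ℂ) * ((a t + ξ * b t) ^ 2)⁻¹) S := by
  intro ξ₀ h₀
  obtain ⟨U, hU, c, hc, hlow⟩ := hS ξ₀ h₀
  have hmeas : ∀ ξ : ℂ, AEStronglyMeasurable (fun t : ℝ =>
      (m t : ℂ) * ((a t + ξ * b t) ^ 2)⁻¹) (volume.restrict (Ioi 0)) := fun ξ => by
    apply Measurable.aestronglyMeasurable; fun_prop
  have hbound : ∀ ξ ∈ U, ∀ t : ℝ, 0 < t → ‖((a t + ξ * b t) ^ 2)⁻¹‖ ≤ (c ^ 2)⁻¹ / q t ^ 2 := by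
    intro ξ hξ t ht
    have hq := hq0 t ht
    rw [norm_inv, norm_pow, div_eq_mul_inv, ← mul_inv, ← mul_pow]
    exact inv_anti₀ (by positivity) (pow_le_pow_left₀ (by positivity) (hlow ξ hξ t ht) 2)
  refine (HasDerivAt.differentiableAt (hasDerivAt_integral_of_dominated_loc_of_deriv_le
    (μ := volume.restrict (Ioi (0 : ℝ))) (s := U)
    (bound := fun t => (m t / q t ^ 2) * (2 * (c ^ 2)⁻¹ * c⁻¹))
    (F' := fun ξ t => (m t : ℂ) * (-(2 * b t * (a t + ξ * b t)⁻¹) * ((a t + ξ * b t) ^ 2)⁻¹))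
    hU (Eventually.of_forall hmeas) ?_ ?_ ?_ ?_ ?_).2).differentiableWithinAt
  · refine Integrable.mono' (hint.mul_const (c ^ 2)⁻¹) (hmeas _) ?_
    refine (ae_restrict_mem measurableSet_Ioi).mono fun t ht => ?_
    rw [norm_mul, Complex.norm_of_nonneg (hm0 t ht)]
    refine (mul_le_mul_of_nonneg_left (hbound ξ₀ (mem_of_mem_nhds hU) t ht) (hm0 t ht)).trans_eq ?_
    ring
  · apply Measurable.aestronglyMeasurable; fun_prop
  · refine (ae_restrict_mem measurableSet_Ioi).mono fun t ht ξ hξ => ?_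
    have hq := hq0 t ht
    have h1 : ‖b t‖ * ‖a t + ξ * b t‖⁻¹ ≤ c⁻¹ := by
      have hpos : 0 < ‖a t + ξ * b t‖ := lt_of_lt_of_le (by positivity) (hlow ξ hξ t ht)
      rw [← div_eq_mul_inv, div_le_iff₀ hpos, inv_mul_eq_div, le_div_iff₀ hc]
      calc ‖b t‖ * c ≤ q t * c := by gcongr; exact hbq t ht
        _ ≤ _ := by rw [mul_comm]; exact hlow ξ hξ t ht
    rw [norm_mul, Complex.norm_of_nonneg (hm0 t ht), norm_mul, norm_neg, norm_mul, norm_mul,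
      norm_inv (a t + ξ * b t), Complex.norm_ofNat]
    calc m t * (2 * ‖b t‖ * ‖a t + ξ * b t‖⁻¹ * ‖((a t + ξ * b t) ^ 2)⁻¹‖)
        = m t * (2 * (‖b t‖ * ‖a t + ξ * b t‖⁻¹) * ‖((a t + ξ * b t) ^ 2)⁻¹‖) := by ring
      _ ≤ m t * (2 * c⁻¹ * ((c ^ 2)⁻¹ / q t ^ 2)) := by
          have := hm0 t ht
          have := hbound ξ hξ t ht
          gcongr
      _ = _ := by ring
  · exact hint.mul_const _
  · refine (ae_restrict_mem measurableSet_Ioi).mono fun t ht ξ hξ => ?_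
    have hq := hq0 t ht
    have hne : a t + ξ * b t ≠ 0 :=
      norm_pos_iff.1 (lt_of_lt_of_le (by positivity) (hlow ξ hξ t ht))
    have h1 : HasDerivAt (fun ξ : ℂ => a t + ξ * b t) (1 * b t) ξ :=
      ((hasDerivAt_id ξ).mul_const _).const_add _
    have h2 := (((h1.pow 2).inv (pow_ne_zero 2 hne))).const_mul (m t : ℂ)
    refine h2.congr_deriv ?_
    simp only [Pi.pow_apply, Nat.cast_ofNat, Nat.add_one_sub_one, pow_one]
    field_simp

/-- The integral `∫₀^∞ t ^ (s - 1) e ^ {-t} / (1 - ξ e ^ {-t}) ^ 2 dt`. -/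
noncomputable def polylogSqIntegral (s : ℝ) (ξ : ℂ) : ℂ :=
  ∫ t in Ioi (0 : ℝ),
    ((Real.exp (-t) * t ^ (s - 1) : ℝ) : ℂ) * ((1 + ξ * (-Real.exp (-t) : ℝ)) ^ 2)⁻¹

theorem differentiableOn_polylogSqIntegral {s : ℝ} (hs : 0 < s) :
    DifferentiableOn ℂ (polylogSqIntegral s) splitPlane := by
  refine differentiableOn_integral_inv_sq (m := fun t => Real.exp (-t) * t ^ (s - 1))
    (q := fun _ => 1) (a := fun _ => 1) (b := fun t => ((-Real.exp (-t) : ℝ) : ℂ))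
    (by fun_prop) (by fun_prop) (by fun_prop)
    (fun t ht => mul_nonneg (Real.exp_pos _).le (Real.rpow_nonneg ht.le _))
    (fun _ _ => one_pos) (fun t ht => ?_) (by simpa using Real.GammaIntegral_convergent hs) ?_
  · rw [Complex.norm_real, norm_neg, Real.norm_of_nonneg (Real.exp_pos _).le]
    exact (exp_neg_mem ht).2
  · intro ξ₀ h₀
    obtain ⟨U, hU, c, hc, -, hb⟩ := exists_lower_bound h₀
    refine ⟨U, hU, c, hc, fun ξ hξ t ht => ?_⟩
    have := hb ξ hξ _ (exp_neg_mem ht)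
    simpa [sub_eq_add_neg] using this

/-- Expand `(1 - x)⁻²` as `∑ (j + 1) x ^ j` and integrate termwise; each term is a Gamma integral.
-/
theorem hasSum_polylogSqIntegral {s : ℝ} (hs : 0 < s) {ξ : ℂ} (hξ : ‖ξ‖ < 1) :
    HasSum (fun j : ℕ => ((Real.Gamma s : ℝ) : ℂ) *
      (((j + 1 : ℕ) : ℂ) * ξ ^ j / ((((j + 1 : ℕ) : ℝ) ^ s : ℝ) : ℂ)))
      (polylogSqIntegral s ξ) := by
  have hint : ∀ j : ℕ, ∫ t in Ioi (0 : ℝ), t ^ (s - 1) * Real.exp (-(((j + 1 : ℕ) : ℝ) * t)) =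
      Real.Gamma s / (((j + 1 : ℕ) : ℝ) ^ s) := fun j => by
    rw [Real.integral_rpow_mul_exp_neg_mul_Ioi hs (by positivity), one_div,
      Real.inv_rpow (by positivity)]
    field_simp
  have hI : ∀ j : ℕ, IntegrableOn
      (fun t : ℝ => t ^ (s - 1) * Real.exp (-(((j + 1 : ℕ) : ℝ) * t))) (Ioi 0) := fun j => by
    -- A nonintegrable function has integral zero by convention, whereas the value in `hint` is
    -- positive.
    by_contra h
    have h1 := hint j
    rw [integral_undef h] at h1
    have : 0 < Real.Gamma s / (((j + 1 : ℕ) : ℝ) ^ s) :=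
      div_pos (Real.Gamma_pos_of_pos hs) (by positivity)
    linarith
  have hF : ∀ j : ℕ, ∀ t : ℝ, ((Real.exp (-t) * t ^ (s - 1) : ℝ) : ℂ) *
      (((j + 1 : ℕ) : ℂ) * (ξ * (Real.exp (-t) : ℝ)) ^ j) =
      (((j + 1 : ℕ) : ℂ) * ξ ^ j) *
        ((t ^ (s - 1) * Real.exp (-(((j + 1 : ℕ) : ℝ) * t)) : ℝ) : ℂ) := fun j t => by
    have : Real.exp (-(((j + 1 : ℕ) : ℝ) * t)) = Real.exp (-t) ^ j * Real.exp (-t) := by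
      rw [← pow_succ, ← Real.exp_nat_mul]; congr 1; ring
    rw [this]; push_cast; ring
  have key := hasSum_integral_of_summable_integral_norm
    (μ := volume.restrict (Ioi (0 : ℝ)))
    (F := fun (j : ℕ) (t : ℝ) => (((j + 1 : ℕ) : ℂ) * ξ ^ j) *
      ((t ^ (s - 1) * Real.exp (-(((j + 1 : ℕ) : ℝ) * t)) : ℝ) : ℂ))
    (fun j => (hI j).ofReal.const_mul _) ?_
  · have e1 : ∀ j : ℕ, ∫ t in Ioi (0 : ℝ), (((j + 1 : ℕ) : ℂ) * ξ ^ j) *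
        ((t ^ (s - 1) * Real.exp (-(((j + 1 : ℕ) : ℝ) * t)) : ℝ) : ℂ) =
        ((Real.Gamma s : ℝ) : ℂ) *
          (((j + 1 : ℕ) : ℂ) * ξ ^ j / ((((j + 1 : ℕ) : ℝ) ^ s : ℝ) : ℂ)) := fun j => by
      rw [integral_const_mul, integral_complex_ofReal, hint j]
      push_cast; ring
    simp_rw [e1] at key
    refine (congrArg (HasSum _) ?_).mp key
    rw [polylogSqIntegral]
    symm
    refine setIntegral_congr_fun measurableSet_Ioi fun t ht => ?_
    have hlt : ‖ξ * (Real.exp (-t) : ℝ)‖ < 1 := by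
      rw [norm_mul, Complex.norm_real, Real.norm_of_nonneg (exp_neg_mem ht).1]
      exact lt_of_le_of_lt (mul_le_of_le_one_right (norm_nonneg _) (exp_neg_mem ht).2) hξ
    have hg := (hasSum_choose_mul_geometric_of_norm_lt_one 1 hlt).mul_left
      ((Real.exp (-t) * t ^ (s - 1) : ℝ) : ℂ)
    simp only [Nat.choose_one_right, hF] at hg
    refine Eq.trans ?_ hg.tsum_eq.symm
    simp only [Complex.ofReal_neg, mul_neg, ← sub_eq_add_neg, one_div]
  · have e2 : ∀ j : ℕ, ∫ t in Ioi (0 : ℝ), ‖(((j + 1 : ℕ) : ℂ) * ξ ^ j) *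
        ((t ^ (s - 1) * Real.exp (-(((j + 1 : ℕ) : ℝ) * t)) : ℝ) : ℂ)‖ =
        (((j + 1 : ℕ) : ℝ) * ‖ξ‖ ^ j) * (Real.Gamma s / (((j + 1 : ℕ) : ℝ) ^ s)) := fun j => by
      rw [← hint j, ← integral_const_mul]
      refine setIntegral_congr_fun measurableSet_Ioi fun t ht => ?_
      have : 0 ≤ t ^ (s - 1) * Real.exp (-(((j + 1 : ℕ) : ℝ) * t)) :=
        mul_nonneg (Real.rpow_nonneg (mem_Ioi.1 ht).le _) (Real.exp_pos _).le
      simp only [norm_mul, norm_pow, Complex.norm_real, Complex.norm_natCast]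
      rw [← norm_mul, Real.norm_of_nonneg this]
    simp_rw [e2]
    have hsum : Summable fun j : ℕ => ((j + 1 : ℕ) : ℝ) * ‖ξ‖ ^ j := by
      have := (hasSum_choose_mul_geometric_of_norm_lt_one 1
        (show ‖‖ξ‖‖ < 1 by rwa [norm_norm])).summable
      simpa only [Nat.choose_one_right] using this
    refine Summable.of_nonneg_of_le (fun j => ?_) (fun j => ?_) (hsum.mul_right (Real.Gamma s))
    · have := (Real.Gamma_pos_of_pos hs).le
      positivity
    · refine mul_le_mul_of_nonneg_left ?_ (by positivity)
      refine div_le_self (Real.Gamma_pos_of_pos hs).le ?_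
      exact Real.one_le_rpow (by simp) hs.le

/-- The squared denominator lowers the order by one. This reaches orders in `(-1, 0)`, where the
usual integral with a simple denominator diverges at `t = 0`. -/
theorem isPolylog_polylogSqIntegral {s : ℝ} (hs : 0 < s) :
    IsPolylog (s - 1) fun ξ => ξ * (((Real.Gamma s : ℝ) : ℂ)⁻¹ * polylogSqIntegral s ξ) where
  differentiableOn :=
    differentiableOn_id.mul ((differentiableOn_polylogSqIntegral hs).const_mul _)
  hasSum ξ hξ := by
    have hΓ : ((Real.Gamma s : ℝ) : ℂ) ≠ 0 := by
      exact_mod_cast (Real.Gamma_pos_of_pos hs).ne'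
    refine (((hasSum_polylogSqIntegral hs hξ).mul_left
      (((Real.Gamma s : ℝ) : ℂ))⁻¹).mul_left ξ).congr_fun fun j => ?_
    have hj : (((j + 1 : ℕ) : ℝ)) ≠ 0 := by positivity
    have hj0 : (0 : ℝ) < ((j + 1 : ℕ) : ℝ) := by positivity
    have hjc : ((((j + 1 : ℕ) : ℝ) ^ s : ℝ) : ℂ) ≠ 0 := by
      exact_mod_cast (Real.rpow_pos_of_pos hj0 s).ne'
    have hj' : ((j : ℂ) + 1) ≠ 0 := by exact_mod_cast hj
    rw [inv_mul_cancel_left₀ hΓ, Real.rpow_sub_one hj]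
    push_cast at hjc ⊢
    field_simp
    ring

/-! ### Uniqueness of the continuation to the split plane. -/

theorem mem_splitPlane_iff {ξ : ℂ} : ξ ∈ splitPlane ↔ 1 - ξ ∈ Complex.slitPlane := by
  rw [splitPlane, mem_compl_iff, Complex.mem_slitPlane_iff_not_le_zero, not_iff_not]
  constructor
  · rintro ⟨x, hx, rfl⟩
    rw [Complex.le_def]
    have := mem_Ici.1 hx
    simpa using this
  · intro h
    rw [Complex.le_def] at h
    simp only [Complex.sub_re, Complex.one_re, Complex.zero_re, Complex.sub_im, Complex.one_im,
      Complex.zero_im, zero_sub, neg_eq_zero] at h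
    exact ⟨ξ.re, by simpa using h.1, Complex.ext rfl (by simp [h.2])⟩

theorem isPreconnected_slitPlane : IsPreconnected Complex.slitPlane :=
  (Complex.starConvex_one_slitPlane.isPathConnected
    Complex.one_mem_slitPlane).isConnected.isPreconnected

theorem isPreconnected_splitPlane : IsPreconnected splitPlane := by
  have : splitPlane = (fun w : ℂ => 1 - w) '' Complex.slitPlane := by
    ext ξ
    rw [mem_splitPlane_iff]
    exact ⟨fun h => ⟨1 - ξ, h, by simp⟩, by rintro ⟨w, hw, rfl⟩; simpa using hw⟩
  rw [this]
  exact isPreconnected_slitPlane.image _ (by fun_prop)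

/-- Identity theorem on a connected open set. Since `polylog` is only a chosen witness, this is what
gives access to explicit formulas for it. -/
theorem IsPolylog.eqOn {p : ℝ} {L M : ℂ → ℂ} (hL : IsPolylog p L) (hM : IsPolylog p M) :
    EqOn L M splitPlane := by
  refine (hL.differentiableOn.analyticOnNhd isOpen_splitPlane).eqOn_of_preconnected_of_eventuallyEq
    (hM.differentiableOn.analyticOnNhd isOpen_splitPlane) isPreconnected_splitPlane
    (z₀ := 0) (by rw [mem_splitPlane_iff]; simp) ?_
  filter_upwards [Metric.ball_mem_nhds (0 : ℂ) one_pos] with ξ hξ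
  have hξ' : ‖ξ‖ < 1 := by simpa using hξ
  exact (hL.hasSum ξ hξ').unique (hM.hasSum ξ hξ')

theorem polylog_eq_integral {α : ℝ} (hα : 0 < α) {ξ : ℂ} (hξ : ξ ∈ splitPlane) :
    polylog (α - 1) ξ = ξ * (((Real.Gamma α : ℝ) : ℂ)⁻¹ * polylogSqIntegral α ξ) :=
  (isPolylog_polylog (by linarith)).eqOn (isPolylog_polylogSqIntegral hα) hξ

/-! ### The Stieltjes transform of a power -/

theorem lintegral_rpow_mul_exp_neg {a r : ℝ} (ha : 0 < a) (hr : 0 < r) :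
    ∫⁻ t in Ioi (0 : ℝ), ENNReal.ofReal (t ^ (a - 1) * Real.exp (-(r * t))) =
      ENNReal.ofReal ((1 / r) ^ a * Real.Gamma a) := by
  have h := Real.integral_rpow_mul_exp_neg_mul_Ioi ha hr
  have hpos : 0 < (1 / r) ^ a * Real.Gamma a :=
    mul_pos (by positivity) (Real.Gamma_pos_of_pos ha)
  rw [← h, ofReal_integral_eq_lintegral_ofReal]
  · by_contra hn
    rw [integral_undef hn] at h
    exact hpos.ne h
  · refine (ae_restrict_mem measurableSet_Ioi).mono fun t ht => ?_
    exact mul_nonneg (Real.rpow_nonneg (mem_Ioi.1 ht).le _) (Real.exp_pos _).le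

/-- Write `(t + x)⁻²` as the integral of `s e ^ {-(t + x) s}` and apply Tonelli: the `t`-integral
gives `Γ(α) s ^ {-α}`, then the `s`-integral gives `Γ(2 - α)`. Lower integrals yield value and
integrability together. -/
theorem lintegral_rpow_div_add_sq {α x : ℝ} (hα0 : 0 < α) (hα1 : α < 1) (hx : 0 < x) :
    ∫⁻ t in Ioi (0 : ℝ), ENNReal.ofReal (t ^ (α - 1) / (t + x) ^ 2) =
      ENNReal.ofReal (Real.Gamma α * Real.Gamma (2 - α) * x ^ (α - 2)) := by
  have hswap := lintegral_lintegral_swap (μ := volume.restrict (Ioi (0 : ℝ)))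
    (ν := volume.restrict (Ioi (0 : ℝ)))
    (f := fun t s : ℝ => ENNReal.ofReal (t ^ (α - 1) * (s * Real.exp (-((t + x) * s)))))
    (by apply Measurable.aemeasurable; fun_prop)
  have hl : ∀ t ∈ Ioi (0 : ℝ), ∫⁻ s in Ioi (0 : ℝ),
      ENNReal.ofReal (t ^ (α - 1) * (s * Real.exp (-((t + x) * s)))) =
      ENNReal.ofReal (t ^ (α - 1) / (t + x) ^ 2) := by
    intro t ht
    have ht0 : 0 < t := ht
    have h := lintegral_rpow_mul_exp_neg (a := 2) (r := t + x) two_pos (by positivity)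
    have hΓ : Real.Gamma 2 = 1 := by simp
    norm_num [hΓ] at h
    simp_rw [ENNReal.ofReal_mul (Real.rpow_nonneg ht0.le (α - 1))]
    rw [lintegral_const_mul _ (by fun_prop), h, ← ENNReal.ofReal_mul (by positivity)]
    rfl
  have hr : ∀ s ∈ Ioi (0 : ℝ), ∫⁻ t in Ioi (0 : ℝ),
      ENNReal.ofReal (t ^ (α - 1) * (s * Real.exp (-((t + x) * s)))) =
      ENNReal.ofReal (Real.Gamma α) *
        ENNReal.ofReal (s ^ ((2 - α) - 1) * Real.exp (-(x * s))) := by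
    intro s hs
    have hs0 : 0 < s := hs
    have h := lintegral_rpow_mul_exp_neg (a := α) (r := s) hα0 hs0
    have e : ∀ t : ℝ, t ^ (α - 1) * (s * Real.exp (-((t + x) * s))) =
        (s * Real.exp (-(x * s))) * (t ^ (α - 1) * Real.exp (-(s * t))) := fun t => by
      rw [show -((t + x) * s) = -(x * s) + -(s * t) by ring, Real.exp_add]; ring
    simp_rw [e]
    simp_rw [ENNReal.ofReal_mul (show 0 ≤ s * Real.exp (-(x * s)) by positivity)]
    rw [lintegral_const_mul _ (by fun_prop), h, ← ENNReal.ofReal_mul (by positivity),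
      ← ENNReal.ofReal_mul (Real.Gamma_pos_of_pos hα0).le]
    congr 1
    have : s ^ ((2 - α) - 1) = s * (1 / s) ^ α := by
      rw [show (2 - α) - 1 = 1 - α by ring, Real.rpow_sub hs0, Real.rpow_one, one_div,
        Real.inv_rpow hs0.le]
      rfl
    rw [this]; ring
  rw [setLIntegral_congr_fun measurableSet_Ioi hl, setLIntegral_congr_fun measurableSet_Ioi hr,
    lintegral_const_mul _ (by fun_prop), lintegral_rpow_mul_exp_neg (by linarith) hx,
    ← ENNReal.ofReal_mul (Real.Gamma_pos_of_pos hα0).le] at hswap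
  rw [hswap]
  congr 1
  have : x ^ (α - 2) = (1 / x) ^ (2 - α) := by
    rw [one_div, Real.inv_rpow hx.le, ← Real.rpow_neg hx.le]; congr 1; ring
  rw [this]; ring

theorem integrableOn_rpow_div_add_sq {α x : ℝ} (hα0 : 0 < α) (hα1 : α < 1) (hx : 0 < x) :
    IntegrableOn (fun t : ℝ => t ^ (α - 1) / (t + x) ^ 2) (Ioi 0) := by
  refine ⟨by apply Measurable.aestronglyMeasurable; fun_prop, ?_⟩
  rw [hasFiniteIntegral_iff_ofReal, lintegral_rpow_div_add_sq hα0 hα1 hx]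
  · exact ENNReal.ofReal_lt_top
  · refine (ae_restrict_mem measurableSet_Ioi).mono fun t ht => ?_
    exact div_nonneg (Real.rpow_nonneg (mem_Ioi.1 ht).le _) (sq_nonneg _)

theorem integral_rpow_div_add_sq {α x : ℝ} (hα0 : 0 < α) (hα1 : α < 1) (hx : 0 < x) :
    ∫ t in Ioi (0 : ℝ), t ^ (α - 1) / (t + x) ^ 2 =
      Real.Gamma α * Real.Gamma (2 - α) * x ^ (α - 2) := by
  have h1 := Real.Gamma_pos_of_pos hα0
  have h2 := Real.Gamma_pos_of_pos (show 0 < 2 - α by linarith)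
  rw [integral_eq_lintegral_of_nonneg_ae, lintegral_rpow_div_add_sq hα0 hα1 hx,
    ENNReal.toReal_ofReal (by positivity)]
  · refine (ae_restrict_mem measurableSet_Ioi).mono fun t ht => ?_
    exact div_nonneg (Real.rpow_nonneg (mem_Ioi.1 ht).le _) (sq_nonneg _)
  · apply Measurable.aestronglyMeasurable; fun_prop

theorem exists_lower_bound_add_ofReal {w₀ : ℂ} (h₀ : w₀ ∈ Complex.slitPlane) :
    ∃ U ∈ 𝓝 w₀, ∃ c : ℝ, 0 < c ∧ ∀ w ∈ U, ∀ t : ℝ, 0 < t → c * (t + 1) ≤ ‖(t : ℂ) + w * 1‖ := by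
  -- The bound `|w + t| ≥ cos (arg w / 2) (|w| + t)` together with `|w| + t ≥ min |w| 1 (t + 1)`
  -- makes `f w` an admissible constant at `w`; continuity off the cut allows half of `f w₀` nearby.
  set f : ℂ → ℝ := fun w => Real.cos (w.arg / 2) * min ‖w‖ 1
  have hf : ContinuousAt f w₀ := by
    have := Complex.continuousAt_arg h₀
    fun_prop
  have harg := abs_lt.1 (lt_of_le_of_ne (Complex.abs_arg_le_pi w₀)
    (fun h => (Complex.mem_slitPlane_iff_arg.1 h₀).1 (by
      rcases abs_eq Real.pi_pos.le |>.1 h with h | h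
      · exact h
      · exact absurd h (Complex.neg_pi_lt_arg w₀).ne')))
  have hpos : 0 < f w₀ := mul_pos
    (Real.cos_pos_of_mem_Ioo ⟨by linarith [harg.1], by linarith [harg.2]⟩)
    (lt_min (norm_pos_iff.2 (Complex.slitPlane_ne_zero h₀)) one_pos)
  refine ⟨_, hf.eventually (lt_mem_nhds (half_lt_self hpos)), f w₀ / 2, half_pos hpos,
    fun w hw t ht => ?_⟩
  have hw' : f w₀ / 2 < f w := hw
  have hc : 0 ≤ Real.cos (w.arg / 2) := Real.cos_nonneg_of_mem_Icc
    ⟨by linarith [Complex.neg_pi_lt_arg w], by linarith [Complex.arg_le_pi w]⟩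
  calc f w₀ / 2 * (t + 1) ≤ f w * (t + 1) := by gcongr
    _ = Real.cos (w.arg / 2) * (min ‖w‖ 1 * t + min ‖w‖ 1) := by simp only [f]; ring
    _ ≤ Real.cos (w.arg / 2) * (‖w‖ + t) := by
        have h1 := min_le_left ‖w‖ 1
        have h2 := min_le_right ‖w‖ 1
        refine mul_le_mul_of_nonneg_left ?_ hc
        nlinarith
    _ ≤ ‖w + t‖ := norm_add_ofReal_ge w t
    _ = _ := by rw [mul_one, add_comm]

/-- The integral `∫₀^∞ t ^ (α - 1) / (t + w) ^ 2 dt`. -/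
noncomputable def stieltjesSqIntegral (α : ℝ) (w : ℂ) : ℂ :=
  ∫ t in Ioi (0 : ℝ), ((t ^ (α - 1) : ℝ) : ℂ) * (((t : ℂ) + w * 1) ^ 2)⁻¹

/-- Both sides are holomorphic on the slit plane and agree on the positive reals, which accumulate
at `1`. -/
theorem stieltjesSqIntegral_eq {α : ℝ} (hα0 : 0 < α) (hα1 : α < 1) {w : ℂ}
    (hw : w ∈ Complex.slitPlane) : stieltjesSqIntegral α w =
      ((Real.Gamma α * Real.Gamma (2 - α) : ℝ) : ℂ) * w ^ ((α : ℂ) - 2) := by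
  have hd : DifferentiableOn ℂ (stieltjesSqIntegral α) Complex.slitPlane := by
    refine differentiableOn_integral_inv_sq (m := fun t => t ^ (α - 1)) (q := fun t => t + 1)
      (a := fun t => (t : ℂ)) (b := fun _ => 1) (by fun_prop) (by fun_prop) (by fun_prop)
      (fun t ht => Real.rpow_nonneg ht.le _) (fun t ht => by linarith)
      (fun t ht => by simpa using ht.le) (integrableOn_rpow_div_add_sq hα0 hα1 one_pos)
      fun w₀ h₀ => exists_lower_bound_add_ofReal h₀
  have hd' : DifferentiableOn ℂ (fun w : ℂ =>
      ((Real.Gamma α * Real.Gamma (2 - α) : ℝ) : ℂ) * w ^ ((α : ℂ) - 2)) Complex.slitPlane :=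
    fun w hw => (((differentiableAt_id (x := w)).cpow_const hw).const_mul
      ((Real.Gamma α * Real.Gamma (2 - α) : ℝ) : ℂ)).differentiableWithinAt
  refine (hd.analyticOnNhd Complex.isOpen_slitPlane).eqOn_of_preconnected_of_frequently_eq
    (hd'.analyticOnNhd Complex.isOpen_slitPlane) isPreconnected_slitPlane
    Complex.one_mem_slitPlane ?_ hw
  have hreal : ∀ x : ℝ, 0 < x → stieltjesSqIntegral α x =
      ((Real.Gamma α * Real.Gamma (2 - α) : ℝ) : ℂ) * (x : ℂ) ^ ((α : ℂ) - 2) := by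
    intro x hx
    have e : (x : ℂ) ^ ((α : ℂ) - 2) = ((x ^ (α - 2) : ℝ) : ℂ) := by
      rw [Complex.ofReal_cpow hx.le]; push_cast; rfl
    rw [e, ← Complex.ofReal_mul, ← integral_rpow_div_add_sq hα0 hα1 hx, ← integral_complex_ofReal]
    refine integral_congr_ae (Eventually.of_forall fun t => ?_)
    push_cast
    rw [mul_one, div_eq_mul_inv]
  have ht : Tendsto (fun n : ℕ => ((1 + 1 / ((n : ℝ) + 1) : ℝ) : ℂ)) atTop (𝓝[≠] 1) := by
    rw [tendsto_nhdsWithin_iff]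
    constructor
    · have h := (tendsto_one_div_add_atTop_nhds_zero_nat (𝕜 := ℝ)).const_add 1
      rw [add_zero] at h
      have := (Complex.continuous_ofReal.tendsto (1 : ℝ)).comp h
      rwa [Complex.ofReal_one] at this
    · refine Eventually.of_forall fun n => ?_
      have : (0 : ℝ) < 1 / ((n : ℝ) + 1) := by positivity
      intro h
      have h' : ((1 + 1 / ((n : ℝ) + 1) : ℝ) : ℂ) = ((1 : ℝ) : ℂ) := by simpa using h
      have := Complex.ofReal_injective h'
      linarith
  exact ht.frequently (Frequently.of_forall fun n => hreal _ (by positivity))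

/-! ### Bounds for exponentials near the origin -/

theorem one_sub_exp_neg_ne_zero {u : ℂ} (hu : u ≠ 0) (him : |u.im| ≤ Real.pi) :
    1 - Complex.exp (-u) ≠ 0 := by
  intro h
  obtain ⟨n, hn⟩ := Complex.exp_eq_one_iff.1 (sub_eq_zero.1 h).symm
  have him' : u.im = -(n * (2 * Real.pi)) := by
    have := congrArg Complex.im hn
    simp at this
    linarith
  have hπ := Real.pi_pos
  have hn0 : n = 0 := by
    rw [him', abs_neg, abs_mul, abs_of_pos (show 0 < 2 * Real.pi by linarith)] at him
    have h1 : |(n : ℝ)| < 1 := by nlinarith [abs_nonneg (n : ℝ)]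
    have h2 : |n| < 1 := by exact_mod_cast h1
    exact Int.abs_lt_one_iff.1 h2
  subst hn0
  simp at hn
  exact hu hn

/-- The quotient `(1 - e ^ {-u}) / u`, with value `1` at the origin, is continuous and has no zero
on the compact truncated strip. -/
theorem exists_mul_norm_le_norm_one_sub_exp_neg (N : ℝ) :
    ∃ c : ℝ, 0 < c ∧ ∀ u : ℂ, ‖u‖ ≤ N → |u.im| ≤ Real.pi → c * ‖u‖ ≤ ‖1 - Complex.exp (-u)‖ := by
  set f : ℂ → ℂ := fun u => 1 - Complex.exp (-u)
  have hf : Differentiable ℂ f := by fun_prop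
  have hd : Continuous (dslope f 0) := by
    rw [← continuousOn_univ, continuousOn_dslope univ_mem]
    exact ⟨hf.continuous.continuousOn, hf 0⟩
  have hK : IsCompact (Metric.closedBall (0 : ℂ) N ∩ {u | |u.im| ≤ Real.pi}) :=
    (isCompact_closedBall _ _).inter_right
      (isClosed_le (by fun_prop) continuous_const)
  obtain ⟨c, hc, hmin⟩ := hK.exists_forall_le' (f := fun u => ‖dslope f 0 u‖) (a := 0)
    hd.norm.continuousOn (fun u hu => by
      rw [norm_pos_iff]
      rcases eq_or_ne u 0 with rfl | h0
      · have : HasDerivAt f (-(Complex.exp (-0) * (-1))) 0 :=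
          (((hasDerivAt_id (0 : ℂ)).neg).cexp).const_sub 1
        rw [dslope_same, this.deriv]
        simp
      · rw [dslope_of_ne _ h0, slope_def_field]
        have : f 0 = 0 := by simp [f]
        rw [this, sub_zero, sub_zero]
        exact div_ne_zero (one_sub_exp_neg_ne_zero h0 hu.2) h0)
  refine ⟨c, hc, fun u hu him => ?_⟩
  have h := hmin u ⟨by simpa using hu, him⟩
  have e : f u = u * dslope f 0 u := by
    have := sub_smul_dslope f 0 u
    have h0 : f 0 = 0 := by simp [f]
    rw [h0, sub_zero, sub_zero, smul_eq_mul] at this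
    exact this.symm
  calc c * ‖u‖ ≤ ‖dslope f 0 u‖ * ‖u‖ := by gcongr
    _ = ‖f u‖ := by rw [e, norm_mul, mul_comm]

theorem norm_exp_neg_sub_le (u : ℂ) :
    ‖Complex.exp (-u) - 1 + u‖ ≤ ‖u‖ ^ 2 * Real.exp ‖u‖ := by
  have h := Complex.norm_exp_sub_sum_le_norm_mul_exp (-u) 2
  rw [norm_neg] at h
  refine (congrArg norm ?_).trans_le h
  simp [Finset.sum_range_succ]
  ring

/-- The simple poles at the origin cancel: over the common denominator the numerator is `O(|u|²)`
and the denominator is at least a multiple of `|u|²`. -/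
theorem exists_norm_inv_sub_inv_le (N : ℝ) :
    ∃ C : ℝ, ∀ u : ℂ, u ≠ 0 → ‖u‖ ≤ N → |u.im| ≤ Real.pi →
      ‖u⁻¹ - (1 - Complex.exp (-u))⁻¹‖ ≤ C := by
  obtain ⟨c, hc, hlow⟩ := exists_mul_norm_le_norm_one_sub_exp_neg N
  refine ⟨Real.exp N / c, fun u hu hN him => ?_⟩
  have h0 := one_sub_exp_neg_ne_zero hu him
  have hu0 : 0 < ‖u‖ := norm_pos_iff.2 hu
  rw [inv_sub_inv hu h0, norm_div, norm_mul]
  have e : 1 - Complex.exp (-u) - u = -(Complex.exp (-u) - 1 + u) := by ring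
  rw [e, norm_neg, div_le_div_iff₀ (mul_pos hu0 (norm_pos_iff.2 h0)) hc]
  calc ‖Complex.exp (-u) - 1 + u‖ * c ≤ ‖u‖ ^ 2 * Real.exp ‖u‖ * c := by
        gcongr; exact norm_exp_neg_sub_le u
    _ ≤ ‖u‖ ^ 2 * Real.exp N * c := by gcongr
    _ = Real.exp N * (‖u‖ * (c * ‖u‖)) := by ring
    _ ≤ _ := by gcongr; exact hlow u hN him

/-- The function `e ^ u + e ^ {-u} - 2 = 4 sinh² (u / 2)`. -/
noncomputable def coshSymbol (u : ℂ) : ℂ := Complex.exp u * (1 - Complex.exp (-u)) ^ 2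

theorem coshSymbol_eq (u : ℂ) : coshSymbol u = Complex.exp u + Complex.exp (-u) - 2 := by
  have h : Complex.exp u * Complex.exp (-u) = 1 := by
    rw [← Complex.exp_add, add_neg_cancel, Complex.exp_zero]
  rw [coshSymbol]
  linear_combination (Complex.exp (-u) - 2) * h

/-- Odd powers cancel in `e ^ u + e ^ {-u}`, so no cubic term appears; the fourth order is what
later cancels the double poles. -/
theorem norm_coshSymbol_sub_sq_le (u : ℂ) :
    ‖coshSymbol u - u ^ 2‖ ≤ 2 * Real.exp ‖u‖ * ‖u‖ ^ 4 := by
  have h1 := Complex.norm_exp_sub_sum_le_norm_mul_exp u 4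
  have h2 := Complex.norm_exp_sub_sum_le_norm_mul_exp (-u) 4
  rw [norm_neg] at h2
  have e : coshSymbol u - u ^ 2 =
      (Complex.exp u - ∑ m ∈ Finset.range 4, u ^ m / (m.factorial : ℂ)) +
      (Complex.exp (-u) - ∑ m ∈ Finset.range 4, (-u) ^ m / (m.factorial : ℂ)) := by
    rw [coshSymbol_eq]
    simp [Finset.sum_range_succ, Nat.factorial]
    ring
  rw [e]
  refine (norm_add_le _ _).trans ?_
  linarith

theorem norm_coshSymbol (u : ℂ) :
    ‖coshSymbol u‖ = Real.exp u.re * ‖1 - Complex.exp (-u)‖ ^ 2 := by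
  rw [coshSymbol, norm_mul, norm_pow, Complex.norm_exp]

theorem exists_norm_inv_coshSymbol_sub_le_of_norm_le {N : ℝ} :
    ∃ C : ℝ, 0 ≤ C ∧ ∀ u : ℂ, u ≠ 0 → ‖u‖ ≤ N → |u.im| ≤ Real.pi →
      ‖(coshSymbol u)⁻¹ - (u ^ 2)⁻¹‖ ≤ C := by
  obtain ⟨c, hc, hlow⟩ := exists_mul_norm_le_norm_one_sub_exp_neg N
  refine ⟨2 * Real.exp N / (Real.exp (-N) * c ^ 2), by positivity, fun u hu hN him => ?_⟩
  have hu0 : 0 < ‖u‖ := norm_pos_iff.2 hu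
  have hP : Real.exp (-N) * c ^ 2 * ‖u‖ ^ 2 ≤ ‖coshSymbol u‖ := by
    rw [norm_coshSymbol, mul_assoc, ← mul_pow]
    have hre : -N ≤ u.re := by
      have := (abs_le.1 (Complex.abs_re_le_norm u)).1
      linarith
    gcongr
    exact hlow u hN him
  have hP0 : 0 < ‖coshSymbol u‖ := lt_of_lt_of_le (by positivity) hP
  rw [inv_sub_inv (norm_pos_iff.1 hP0) (pow_ne_zero 2 hu), norm_div, norm_mul, norm_pow,
    div_le_div_iff₀ (by positivity) (by positivity), norm_sub_rev]
  calc ‖coshSymbol u - u ^ 2‖ * (Real.exp (-N) * c ^ 2)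
      ≤ 2 * Real.exp ‖u‖ * ‖u‖ ^ 4 * (Real.exp (-N) * c ^ 2) := by
        gcongr; exact norm_coshSymbol_sub_sq_le u
    _ ≤ 2 * Real.exp N * ‖u‖ ^ 4 * (Real.exp (-N) * c ^ 2) := by gcongr
    _ = 2 * Real.exp N * ((Real.exp (-N) * c ^ 2 * ‖u‖ ^ 2) * ‖u‖ ^ 2) := by ring
    _ ≤ _ := by gcongr

theorem norm_inv_coshSymbol_sub_le_of_two_le_re {u : ℂ} (hu : 2 ≤ u.re) :
    ‖(coshSymbol u)⁻¹ - (u ^ 2)⁻¹‖ ≤ 9 / u.re ^ 2 := by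
  set x := u.re with hx
  have hx0 : 0 < x := by linarith
  have h1 : 1 / 2 ≤ ‖1 - Complex.exp (-u)‖ := by
    have h := norm_sub_norm_le (1 : ℂ) (Complex.exp (-u))
    rw [norm_one, Complex.norm_exp, Complex.neg_re, ← hx] at h
    have : Real.exp (-x) ≤ 1 / 2 := by
      rw [Real.exp_neg, one_div]
      exact inv_anti₀ two_pos (by linarith [Real.add_one_le_exp x])
    linarith
  have h2 : x ^ 2 / 8 ≤ ‖coshSymbol u‖ := by
    rw [norm_coshSymbol]
    have := Real.quadratic_le_exp_of_nonneg hx0.le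
    calc x ^ 2 / 8 = (x ^ 2 / 2) * (1 / 2) ^ 2 := by ring
      _ ≤ _ := by
        gcongr
        linarith
  have h3 : x ^ 2 ≤ ‖u ^ 2‖ := by
    rw [norm_pow]
    exact pow_le_pow_left₀ hx0.le (Complex.re_le_norm u) 2
  refine (norm_sub_le _ _).trans ?_
  rw [norm_inv, norm_inv]
  calc ‖coshSymbol u‖⁻¹ + ‖u ^ 2‖⁻¹ ≤ (x ^ 2 / 8)⁻¹ + (x ^ 2)⁻¹ :=
        add_le_add (inv_anti₀ (by positivity) h2) (inv_anti₀ (by positivity) h3)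
    _ = 9 / x ^ 2 := by field_simp; norm_num

theorem exists_norm_inv_coshSymbol_sub_le :
    ∃ C : ℝ, 0 ≤ C ∧ ∀ w ∈ Complex.slitPlane, ‖w‖ ≤ 5 → |w.im| ≤ Real.pi → ∀ t : ℝ, 0 < t →
      ‖(coshSymbol (t + w))⁻¹ - (((t : ℂ) + w) ^ 2)⁻¹‖ ≤ C / (t + 1) ^ 2 := by
  -- Split at `t = 7`. Below, `|t + w| ≤ 12` and `(t + 1)² ≤ 64`; above, the real part is at least
  -- `t - 5`, hence at least `2` and at least `(t + 1) / 4`, and `9 · 16 = 144`.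
  obtain ⟨C, hC, hb⟩ := exists_norm_inv_coshSymbol_sub_le_of_norm_le (N := 12)
  refine ⟨64 * C + 144, by positivity, fun w hw hN him t ht => ?_⟩
  have hne : (t : ℂ) + w ≠ 0 := by
    intro h
    have : w = ((-t : ℝ) : ℂ) := by push_cast; linear_combination h
    rw [this, Complex.ofReal_mem_slitPlane] at hw
    linarith
  rcases le_total t 7 with h7 | h7
  · have h := hb (t + w) hne (by
      refine (norm_add_le _ _).trans ?_
      rw [Complex.norm_of_nonneg ht.le]; linarith) (by simpa using him)
    refine h.trans ?_
    rw [le_div_iff₀ (by positivity)]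
    have : (t + 1) ^ 2 ≤ 64 := by nlinarith
    nlinarith
  · have hre : t - 5 ≤ ((t : ℂ) + w).re := by
      have := (abs_le.1 (Complex.abs_re_le_norm w)).1
      simp; linarith
    refine (norm_inv_coshSymbol_sub_le_of_two_le_re (by linarith)).trans ?_
    have h4 : (t + 1) / 4 ≤ ((t : ℂ) + w).re := by linarith
    have h5 : ((t + 1) / 4) ^ 2 ≤ ((t : ℂ) + w).re ^ 2 := pow_le_pow_left₀ (by linarith) h4 2
    calc 9 / ((t : ℂ) + w).re ^ 2 ≤ 9 / ((t + 1) / 4) ^ 2 := by gcongr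
      _ = 144 / (t + 1) ^ 2 := by field_simp; norm_num
      _ ≤ _ := by gcongr; linarith

/-! ### The symbol of the time discretization -/

/-- If `e ^ {-w}` were a real `x ≥ 1`, the strip would force `w = -log x`, which lies on the
excluded cut. -/
theorem exp_neg_mem_splitPlane {w : ℂ} (hw : w ∈ Complex.slitPlane) (him : |w.im| ≤ Real.pi) :
    Complex.exp (-w) ∈ splitPlane := by
  rintro ⟨x, hx, h⟩
  have hx1 : (1 : ℝ) ≤ x := hx
  have hx0 : 0 < x := by linarith
  obtain ⟨n, hn⟩ := Complex.exp_eq_exp_iff_exists_int.1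
    ((show Complex.exp (-w) = Complex.exp (Real.log x : ℝ) by
      rw [← Complex.ofReal_exp, Real.exp_log hx0]; exact h.symm))
  have hre : -w.re = Real.log x := by
    have := congrArg Complex.re hn
    simpa using this
  have him' : w.im = -(n * (2 * Real.pi)) := by
    have := congrArg Complex.im hn
    simp at this
    linarith
  have hπ := Real.pi_pos
  have hn0 : n = 0 := by
    rw [him', abs_neg, abs_mul, abs_of_pos (show 0 < 2 * Real.pi by linarith)] at him
    have h1 : |(n : ℝ)| < 1 := by nlinarith [abs_nonneg (n : ℝ)]
    have h2 : |n| < 1 := by exact_mod_cast h1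
    exact Int.abs_lt_one_iff.1 h2
  have hlog := Real.log_nonneg hx1
  rcases Complex.mem_slitPlane_iff.1 hw with h1 | h1
  · linarith
  · apply h1
    rw [him', hn0]; simp

theorem polylog_exp_neg {α : ℝ} (hα : 0 < α) {w : ℂ} (hw : Complex.exp (-w) ∈ splitPlane) :
    polylog (α - 1) (Complex.exp (-w)) = ((Real.Gamma α : ℝ) : ℂ)⁻¹ *
      ∫ t in Ioi (0 : ℝ), ((t ^ (α - 1) : ℝ) : ℂ) * (coshSymbol (t + w))⁻¹ := by
  rw [polylog_eq_integral hα hw, mul_left_comm, polylogSqIntegral, ← integral_const_mul]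
  congr 1
  refine integral_congr_ae (Eventually.of_forall fun t => ?_)
  have e : Complex.exp (-(t + w)) = Complex.exp (-w) * Complex.exp (-t) := by
    rw [← Complex.exp_add]; congr 1; ring
  have e2 : Complex.exp (t + w) = (Complex.exp (-w) * Complex.exp (-t))⁻¹ := by
    rw [← e, Complex.exp_neg, inv_inv]
  simp only [coshSymbol]
  rw [e, e2, mul_inv, inv_inv]
  push_cast
  rw [mul_neg, ← sub_eq_add_neg]
  ring

/-- The Stieltjes integral carries the whole singularity at `w = 0`; the remaining integrand `D` is
dominated by a multiple of `t ^ (α - 1) / (t + 1)²`, independently of `w`. -/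
theorem exists_norm_polylog_exp_neg_sub_le {α : ℝ} (hα0 : 0 < α) (hα1 : α < 1) :
    ∃ C : ℝ, 0 ≤ C ∧ ∀ w ∈ Complex.slitPlane, ‖w‖ ≤ 5 → |w.im| ≤ Real.pi →
      ‖polylog (α - 1) (Complex.exp (-w)) -
        ((Real.Gamma (2 - α) : ℝ) : ℂ) * w ^ ((α : ℂ) - 2)‖ ≤ C := by
  obtain ⟨C, hC, hb⟩ := exists_norm_inv_coshSymbol_sub_le
  have hΓ1 := Real.Gamma_pos_of_pos hα0
  have hΓ2 := Real.Gamma_pos_of_pos (show 0 < 2 - α by linarith)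
  refine ⟨(Real.Gamma α)⁻¹ * (C * (Real.Gamma α * Real.Gamma (2 - α) * 1 ^ (α - 2))),
    by positivity, fun w hw hN him => ?_⟩
  have hI := integrableOn_rpow_div_add_sq hα0 hα1 one_pos
  set f₂ : ℝ → ℂ := fun t => ((t ^ (α - 1) : ℝ) : ℂ) * (((t : ℂ) + w * 1) ^ 2)⁻¹ with hf₂
  set D : ℝ → ℂ := fun t => ((t ^ (α - 1) : ℝ) : ℂ) *
    ((coshSymbol (t + w))⁻¹ - (((t : ℂ) + w) ^ 2)⁻¹) with hD
  have hbD : ∀ t : ℝ, 0 < t → ‖D t‖ ≤ C * (t ^ (α - 1) / (t + 1) ^ 2) := fun t ht => by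
    rw [hD, norm_mul, Complex.norm_of_nonneg (Real.rpow_nonneg ht.le _)]
    calc t ^ (α - 1) * ‖(coshSymbol (t + w))⁻¹ - (((t : ℂ) + w) ^ 2)⁻¹‖
        ≤ t ^ (α - 1) * (C / (t + 1) ^ 2) := by gcongr; exact hb w hw hN him t ht
      _ = _ := by ring
  have hD_int : IntegrableOn D (Ioi 0) := by
    refine Integrable.mono' (hI.const_mul C) ?_
      ((ae_restrict_mem measurableSet_Ioi).mono fun t ht => hbD t ht)
    apply Measurable.aestronglyMeasurable
    simp only [hD, coshSymbol]
    fun_prop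
  have hf_int : IntegrableOn f₂ (Ioi 0) := by
    obtain ⟨U, hU, c, hc, hlow⟩ := exists_lower_bound_add_ofReal hw
    refine Integrable.mono' (hI.const_mul (c ^ 2)⁻¹) ?_
      ((ae_restrict_mem measurableSet_Ioi).mono fun t ht => ?_)
    · apply Measurable.aestronglyMeasurable
      fun_prop
    · have ht0 : 0 < t := ht
      have h := hlow w (mem_of_mem_nhds hU) t ht
      rw [hf₂, norm_mul, Complex.norm_of_nonneg (Real.rpow_nonneg ht0.le _), norm_inv, norm_pow]
      calc t ^ (α - 1) * (‖(t : ℂ) + w * 1‖ ^ 2)⁻¹ ≤ t ^ (α - 1) * ((c * (t + 1)) ^ 2)⁻¹ := by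
            gcongr
        _ = _ := by rw [mul_pow, mul_inv]; ring
  have hsum : ∫ t in Ioi (0 : ℝ), ((t ^ (α - 1) : ℝ) : ℂ) * (coshSymbol (t + w))⁻¹ =
      stieltjesSqIntegral α w + ∫ t in Ioi (0 : ℝ), D t := by
    rw [stieltjesSqIntegral, ← integral_add hf_int hD_int]
    refine integral_congr_ae (Eventually.of_forall fun t => ?_)
    simp only [hD]
    ring
  have hΓc : ((Real.Gamma α : ℝ) : ℂ) ≠ 0 := by exact_mod_cast hΓ1.ne'
  rw [polylog_exp_neg hα0 (exp_neg_mem_splitPlane hw him), hsum,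
    stieltjesSqIntegral_eq hα0 hα1 hw]
  have e : ((Real.Gamma α : ℝ) : ℂ)⁻¹ * (((Real.Gamma α * Real.Gamma (2 - α) : ℝ) : ℂ) *
      w ^ ((α : ℂ) - 2) + ∫ t in Ioi (0 : ℝ), D t) -
      ((Real.Gamma (2 - α) : ℝ) : ℂ) * w ^ ((α : ℂ) - 2) =
      ((Real.Gamma α : ℝ) : ℂ)⁻¹ * ∫ t in Ioi (0 : ℝ), D t := by
    push_cast
    field_simp
    ring
  rw [e, norm_mul, norm_inv, Complex.norm_of_nonneg hΓ1.le]
  gcongr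
  rw [← integral_rpow_div_add_sq hα0 hα1 one_pos, ← integral_const_mul]
  exact norm_integral_le_of_norm_le (hI.const_mul C)
    ((ae_restrict_mem measurableSet_Ioi).mono fun t ht => hbD t ht)

/-- The symbol `(1 - e ^ {-w}) ψ(w)`, so that `χ₁(z) = τ ^ {-α} (1 - e ^ {-zτ}) ψ(zτ)`. -/
noncomputable def symbol (α : ℝ) (w : ℂ) : ℂ := (1 - Complex.exp (-w)) * psi α w

theorem symbol_eq (α : ℝ) (w : ℂ) : symbol α w =
    coshSymbol w / (Real.Gamma (2 - α) : ℝ) * polylog (α - 1) (Complex.exp (-w)) := by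
  have h : Complex.exp w * Complex.exp (-w) = 1 := by
    rw [← Complex.exp_add, add_neg_cancel, Complex.exp_zero]
  have h2 : coshSymbol w = (1 - Complex.exp (-w)) * (Complex.exp w - 1) := by
    rw [coshSymbol]
    linear_combination (Complex.exp (-w) - 1) * h
  rw [symbol, psi, h2]
  ring

theorem exists_norm_symbol_sub_cpow_le {α : ℝ} (hα0 : 0 < α) (hα1 : α < 1) :
    ∃ C : ℝ, 0 < C ∧ ∀ w ∈ Complex.slitPlane, ‖w‖ ≤ 5 → |w.im| ≤ Real.pi →
      ‖symbol α w - w ^ (α : ℂ)‖ ≤ C * (‖w‖ * ‖w ^ (α : ℂ)‖) := by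
  obtain ⟨C, hC, hb⟩ := exists_norm_polylog_exp_neg_sub_le hα0 hα1
  have hΓ2 := Real.Gamma_pos_of_pos (show 0 < 2 - α by linarith)
  have hΓc : ((Real.Gamma (2 - α) : ℝ) : ℂ) ≠ 0 := by exact_mod_cast hΓ2.ne'
  set K : ℝ := 2 * Real.exp 5 * 25 + 1 with hK
  refine ⟨K * 5 / Real.Gamma (2 - α) * C + 2 * Real.exp 5 * 5, by positivity,
    fun w hw hN him => ?_⟩
  have hw0 := Complex.slitPlane_ne_zero hw
  have hn0 : 0 < ‖w‖ := norm_pos_iff.2 hw0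
  have hp2 : w ^ ((α : ℂ) - 2) = w ^ (α : ℂ) / w ^ 2 := by
    rw [Complex.cpow_sub _ _ hw0]
    norm_cast
  have hPs : ‖coshSymbol w - w ^ 2‖ ≤ 2 * Real.exp 5 * ‖w‖ ^ 4 :=
    (norm_coshSymbol_sub_sq_le w).trans (by gcongr)
  have hP : ‖coshSymbol w‖ ≤ K * ‖w‖ ^ 2 := by
    have h := norm_add_le (coshSymbol w - w ^ 2) (w ^ 2)
    rw [sub_add_cancel, norm_pow] at h
    have h4 : ‖w‖ ^ 4 ≤ 25 * ‖w‖ ^ 2 := by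
      have : ‖w‖ ^ 2 ≤ 25 := by nlinarith
      nlinarith [sq_nonneg ‖w‖]
    have : 2 * Real.exp 5 * ‖w‖ ^ 4 ≤ 2 * Real.exp 5 * (25 * ‖w‖ ^ 2) := by gcongr
    rw [hK]
    linarith
  have hnα : ‖w ^ (α : ℂ)‖ = ‖w‖ ^ α := by
    rw [Complex.norm_cpow_of_ne_zero hw0]; simp
  have hlin : ‖w‖ ≤ 5 * ‖w ^ (α : ℂ)‖ := by
    rw [hnα]
    have e : ‖w‖ = ‖w‖ ^ (1 - α) * ‖w‖ ^ α := by
      rw [← Real.rpow_add hn0]; simp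
    have h5 : ‖w‖ ^ (1 - α) ≤ 5 := by
      calc ‖w‖ ^ (1 - α) ≤ 5 ^ (1 - α) := Real.rpow_le_rpow hn0.le hN (by linarith)
        _ ≤ 5 ^ (1 : ℝ) := Real.rpow_le_rpow_of_exponent_le (by norm_num) (by linarith)
        _ = 5 := Real.rpow_one _
    calc ‖w‖ = ‖w‖ ^ (1 - α) * ‖w‖ ^ α := e
      _ ≤ _ := by gcongr
  -- The first term is `O(|w|²)`, hence `O(|w| |w| ^ α)` because `hlin` trades one `|w|` for `|w| ^
  -- α` on the bounded set; the second is `O(|w| ^ (2 + α))`.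
  have e : symbol α w - w ^ (α : ℂ) = coshSymbol w / (Real.Gamma (2 - α) : ℝ) *
      (polylog (α - 1) (Complex.exp (-w)) -
        ((Real.Gamma (2 - α) : ℝ) : ℂ) * w ^ ((α : ℂ) - 2)) +
      (coshSymbol w - w ^ 2) * (w ^ (α : ℂ) / w ^ 2) := by
    rw [symbol_eq, hp2]
    field_simp
    ring
  rw [e]
  refine (norm_add_le _ _).trans ?_
  rw [add_mul]
  refine add_le_add ?_ ?_
  · rw [norm_mul, norm_div, Complex.norm_of_nonneg hΓ2.le]
    calc ‖coshSymbol w‖ / Real.Gamma (2 - α) * _ ≤ K * ‖w‖ ^ 2 / Real.Gamma (2 - α) * C := by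
          gcongr
          exact hb w hw hN him
      _ = K / Real.Gamma (2 - α) * C * (‖w‖ * ‖w‖) := by ring
      _ ≤ K / Real.Gamma (2 - α) * C * (‖w‖ * (5 * ‖w ^ (α : ℂ)‖)) := by gcongr
      _ = _ := by ring
  · rw [norm_mul, norm_div, norm_pow]
    calc ‖coshSymbol w - w ^ 2‖ * (‖w ^ (α : ℂ)‖ / ‖w‖ ^ 2)
        ≤ 2 * Real.exp 5 * ‖w‖ ^ 4 * (‖w ^ (α : ℂ)‖ / ‖w‖ ^ 2) := by gcongr
      _ = 2 * Real.exp 5 * ‖w‖ * (‖w‖ * ‖w ^ (α : ℂ)‖) := by field_simp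
      _ ≤ 2 * Real.exp 5 * 5 * (‖w‖ * ‖w ^ (α : ℂ)‖) := by gcongr

/-! ### Positivity of the symbol on the right half plane -/

/-- The negative second difference `2 (n + 1) ^ p - n ^ p - (n + 2) ^ p`. -/
noncomputable def secondDiff (p : ℝ) (n : ℕ) : ℝ :=
  2 * ((n + 1 : ℕ) : ℝ) ^ p - (n : ℝ) ^ p - ((n + 2 : ℕ) : ℝ) ^ p

theorem secondDiff_nonneg {p : ℝ} (hp0 : 0 < p) (hp1 : p < 1) (n : ℕ) : 0 ≤ secondDiff p n := by
  have h := (Real.concaveOn_rpow hp0.le hp1.le).2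
    (show (n : ℝ) ∈ Ici 0 from mem_Ici.2 (by positivity))
    (show ((n + 2 : ℕ) : ℝ) ∈ Ici 0 from mem_Ici.2 (by positivity))
    (show (0 : ℝ) ≤ 1 / 2 by norm_num) (show (0 : ℝ) ≤ 1 / 2 by norm_num) (by norm_num)
  simp only [smul_eq_mul] at h
  have e : (1 / 2 : ℝ) * n + 1 / 2 * ((n + 2 : ℕ) : ℝ) = ((n + 1 : ℕ) : ℝ) := by push_cast; ring
  rw [e] at h
  rw [secondDiff]
  linarith

theorem secondDiff_zero_pos {p : ℝ} (hp0 : 0 < p) (hp1 : p < 1) : 0 < secondDiff p 0 := by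
  have h : (2 : ℝ) ^ p < 2 := by
    calc (2 : ℝ) ^ p < 2 ^ (1 : ℝ) := Real.rpow_lt_rpow_of_exponent_lt (by norm_num) hp1
      _ = 2 := Real.rpow_one 2
  simp only [secondDiff, zero_add, Nat.cast_one, Real.one_rpow, Nat.cast_zero,
    Real.zero_rpow hp0.ne', Nat.cast_ofNat]
  linarith

theorem sum_secondDiff {p : ℝ} (hp0 : 0 < p) (N : ℕ) :
    ∑ n ∈ Finset.range N, secondDiff p n = 1 - (((N + 1 : ℕ) : ℝ) ^ p - (N : ℝ) ^ p) := by
  induction N with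
  | zero => simp [Real.zero_rpow hp0.ne']
  | succ N ih =>
    rw [Finset.sum_range_succ, ih, secondDiff]
    ring

theorem sum_secondDiff_le_one {p : ℝ} (hp0 : 0 < p) (N : ℕ) :
    ∑ n ∈ Finset.range N, secondDiff p n ≤ 1 := by
  rw [sum_secondDiff hp0]
  have : (N : ℝ) ^ p ≤ ((N + 1 : ℕ) : ℝ) ^ p :=
    Real.rpow_le_rpow (by positivity) (by push_cast; linarith) hp0.le
  linarith

/-- Multiplying by `(1 - ξ)² / ξ = ξ⁻¹ - 2 + ξ` takes second differences of the coefficients `j ^ (1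
- α)`; the isolated `1` is the `j = 1` term divided by `ξ`. -/
theorem hasSum_secondDiff {α : ℝ} (hα0 : 0 < α) (hα1 : α < 1) {ξ : ℂ} (hξ : ‖ξ‖ < 1)
    (h0 : ξ ≠ 0) : HasSum (fun n : ℕ => (secondDiff (1 - α) n : ℂ) * ξ ^ (n + 1))
      (1 - (1 - ξ) ^ 2 / ξ * polylog (α - 1) ξ) := by
  set f : ℕ → ℂ := fun j => (((j : ℝ) ^ (1 - α) : ℝ) : ℂ) * ξ ^ j with hf
  have hf0 : f 0 = 0 := by
    simp [hf, Real.zero_rpow (show 1 - α ≠ 0 by linarith)]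
  have hf1 : f 1 = ξ := by simp [hf]
  have h1 : HasSum (fun j => f (j + 1)) (polylog (α - 1) ξ) := by
    refine ((isPolylog_polylog (p := α - 1) (by linarith)).hasSum ξ hξ).congr_fun fun j => ?_
    rw [hf, show α - 1 = -(1 - α) by ring, Real.rpow_neg (by positivity)]
    push_cast
    rw [div_inv_eq_mul, mul_comm]
  have h2 : HasSum f (polylog (α - 1) ξ) := by
    have := (hasSum_nat_add_iff 1).1 h1
    simpa [hf0] using this
  have h3 : HasSum (fun j => f (j + 2)) (polylog (α - 1) ξ - ξ) := by
    refine (hasSum_nat_add_iff 2).2 ?_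
    simpa [Finset.sum_range_succ, hf0, hf1] using h2
  have h := ((h1.mul_left 2).sub (h2.mul_left ξ)).sub (h3.mul_left ξ⁻¹)
  have e : 2 * polylog (α - 1) ξ - ξ * polylog (α - 1) ξ - ξ⁻¹ * (polylog (α - 1) ξ - ξ) =
      1 - (1 - ξ) ^ 2 / ξ * polylog (α - 1) ξ := by
    field_simp
    ring
  rw [e] at h
  refine h.congr_fun fun n => ?_
  simp only [hf, secondDiff]
  push_cast
  field_simp
  ring

/-- All coefficients are nonnegative with partial sums at most one, so each contributes at most
itself to the subtracted real part. The zeroth term is kept exactly, which leaves a strict gain away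
from `ξ = 1`. -/
theorem re_one_sub_sq_div_mul_polylog_ge {α : ℝ} (hα0 : 0 < α) (hα1 : α < 1) {ξ : ℂ}
    (hξ : ‖ξ‖ < 1) (h0 : ξ ≠ 0) : secondDiff (1 - α) 0 * (1 - ξ.re) ≤
      ((1 - ξ) ^ 2 / ξ * polylog (α - 1) ξ).re := by
  have h := Complex.hasSum_re (hasSum_secondDiff hα0 hα1 hξ h0)
  have hle : (1 - (1 - ξ) ^ 2 / ξ * polylog (α - 1) ξ).re ≤
      1 - secondDiff (1 - α) 0 * (1 - ξ.re) := by
    refine le_of_tendsto h.tendsto_sum_nat ?_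
    filter_upwards [eventually_ge_atTop 1] with N hN
    obtain ⟨M, rfl⟩ := Nat.exists_eq_add_of_le' hN
    have hs := sum_secondDiff_le_one (p := 1 - α) (by linarith) (M + 1)
    rw [Finset.sum_range_succ'] at hs ⊢
    have hterm : ∑ n ∈ Finset.range M, ((secondDiff (1 - α) (n + 1) : ℂ) * ξ ^ (n + 1 + 1)).re ≤
        ∑ n ∈ Finset.range M, secondDiff (1 - α) (n + 1) := by
      refine Finset.sum_le_sum fun n _ => ?_
      rw [Complex.re_ofReal_mul]
      refine mul_le_of_le_one_right (secondDiff_nonneg (by linarith) (by linarith) _) ?_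
      refine (Complex.re_le_norm _).trans ?_
      rw [norm_pow]
      exact pow_le_one₀ (norm_nonneg _) hξ.le
    rw [zero_add, pow_one, Complex.re_ofReal_mul]
    linarith
  rw [Complex.sub_re, Complex.one_re] at hle
  linarith

theorem continuousAt_symbol {α : ℝ} (hα0 : 0 < α) {w : ℂ} (hw : Complex.exp (-w) ∈ splitPlane) :
    ContinuousAt (symbol α) w := by
  have hL : ContinuousAt (polylog (α - 1)) (Complex.exp (-w)) :=
    ((isPolylog_polylog (p := α - 1) (by linarith)).differentiableOn.differentiableAt
      (isOpen_splitPlane.mem_nhds hw)).continuousAt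
  have hL' : ContinuousAt (fun w => polylog (α - 1) (Complex.exp (-w))) w :=
    ContinuousAt.comp (f := fun w : ℂ => Complex.exp (-w)) hL (by fun_prop)
  have h1 : ContinuousAt (fun w : ℂ => (1 - Complex.exp (-w)) *
      ((Complex.exp w - 1) / (Real.Gamma (2 - α) : ℝ))) w := by fun_prop
  refine (h1.mul hL').congr (Eventually.of_forall fun v => ?_)
  simp only [symbol, psi, Pi.mul_apply]
  ring

/-- The series covers `Re w > 0`; the imaginary axis is reached by a limit from the right. An
explicit lower bound survives this limit, strict positivity alone would not. -/
theorem re_symbol_ge {α : ℝ} (hα0 : 0 < α) (hα1 : α < 1) {w : ℂ} (hw : 0 ≤ w.re)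
    (hs : Complex.exp (-w) ∈ splitPlane) :
    secondDiff (1 - α) 0 * (1 - (Complex.exp (-w)).re) / Real.Gamma (2 - α) ≤
      (symbol α w).re := by
  have hΓ := Real.Gamma_pos_of_pos (show 0 < 2 - α by linarith)
  have hpos : ∀ v : ℂ, 0 < v.re →
      secondDiff (1 - α) 0 * (1 - (Complex.exp (-v)).re) / Real.Gamma (2 - α) ≤
        (symbol α v).re := by
    intro v hv
    have hξ : ‖Complex.exp (-v)‖ < 1 := by
      rw [Complex.norm_exp, Real.exp_lt_one_iff]; simpa using hv
    have h := re_one_sub_sq_div_mul_polylog_ge hα0 hα1 hξ (Complex.exp_ne_zero _)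
    have e : symbol α v = ((1 - Complex.exp (-v)) ^ 2 / Complex.exp (-v) *
        polylog (α - 1) (Complex.exp (-v))) / (Real.Gamma (2 - α) : ℝ) := by
      rw [symbol_eq, coshSymbol, Complex.exp_neg v, div_inv_eq_mul]
      ring
    rw [e, Complex.div_ofReal_re]
    gcongr
  have ht : Tendsto (fun x : ℝ => w + (x : ℂ)) (𝓝[>] 0) (𝓝 w) := by
    have : Continuous fun x : ℝ => w + (x : ℂ) := by fun_prop
    simpa using (this.tendsto 0).mono_left nhdsWithin_le_nhds
  have hl : Tendsto (fun x : ℝ => secondDiff (1 - α) 0 *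
      (1 - (Complex.exp (-(w + (x : ℂ)))).re) / Real.Gamma (2 - α)) (𝓝[>] 0)
      (𝓝 (secondDiff (1 - α) 0 * (1 - (Complex.exp (-w)).re) / Real.Gamma (2 - α))) := by
    have hc : Continuous fun v : ℂ =>
        secondDiff (1 - α) 0 * (1 - (Complex.exp (-v)).re) / Real.Gamma (2 - α) := by fun_prop
    exact (hc.tendsto w).comp ht
  have hr : Tendsto (fun x : ℝ => (symbol α (w + (x : ℂ))).re) (𝓝[>] 0) (𝓝 (symbol α w).re) :=
    (Complex.continuous_re.tendsto _).comp ((continuousAt_symbol hα0 hs).tendsto.comp ht)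
  refine le_of_tendsto_of_tendsto hl hr ?_
  filter_upwards [self_mem_nhdsWithin] with x hx
  exact hpos _ (by simpa using add_pos_of_nonneg_of_pos hw hx)

theorem re_symbol_pos {α : ℝ} (hα0 : 0 < α) (hα1 : α < 1) {w : ℂ} (hw : 0 ≤ w.re) (h0 : w ≠ 0)
    (him : |w.im| ≤ Real.pi) (hs : Complex.exp (-w) ∈ splitPlane) : 0 < (symbol α w).re := by
  refine lt_of_lt_of_le (div_pos (mul_pos (secondDiff_zero_pos (by linarith) (by linarith))
    (sub_pos.2 ?_)) (Real.Gamma_pos_of_pos (by linarith))) (re_symbol_ge hα0 hα1 hw hs)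
  have hn : ‖Complex.exp (-w)‖ ≤ 1 := by
    rw [Complex.norm_exp, Real.exp_le_one_iff]; simpa using hw
  refine lt_of_le_of_ne ((Complex.re_le_norm _).trans hn) fun h => ?_
  apply one_sub_exp_neg_ne_zero h0 him
  have hsq : Complex.normSq (Complex.exp (-w)) ≤ 1 := by
    rw [← Complex.sq_norm]; exact pow_le_one₀ (norm_nonneg _) hn
  rw [Complex.normSq_apply, h] at hsq
  have him0 : (Complex.exp (-w)).im = 0 := by nlinarith
  exact sub_eq_zero.2 (Complex.ext h.symm him0.symm)

theorem mem_slitPlane_of_re_nonneg {w : ℂ} (hw : 0 ≤ w.re) (h0 : w ≠ 0) :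
    w ∈ Complex.slitPlane := by
  rw [Complex.mem_slitPlane_iff]
  by_contra! h
  exact h0 (Complex.ext (le_antisymm h.1 hw) h.2)

theorem exists_re_symbol_pos {α ε : ℝ} (hα0 : 0 < α) (hα1 : α < 1) (hε : 0 < ε) :
    ∃ η : ℝ, 0 < η ∧ ∀ w : ℂ, |w.im| ≤ Real.pi → ε ≤ ‖w‖ → ‖w‖ ≤ 5 → -η ≤ w.re →
      0 < (symbol α w).re := by
  -- The radius `ε / 2` leaves room for projecting a point with slightly negative real part onto the
  -- imaginary axis, which lowers its modulus by at most `η ≤ ε / 2`.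
  set K : Set ℂ := Metric.closedBall (0 : ℂ) 5 ∩
    ({w | |w.im| ≤ Real.pi} ∩ ({w | ε / 2 ≤ ‖w‖} ∩ {w | 0 ≤ w.re})) with hKdef
  have hK : IsCompact K := (isCompact_closedBall _ _).inter_right
    ((isClosed_le (by fun_prop) continuous_const).inter
      ((isClosed_le continuous_const continuous_norm).inter
        (isClosed_le continuous_const Complex.continuous_re)))
  set O : Set ℂ := {w | Complex.exp (-w) ∈ splitPlane} ∩ symbol α ⁻¹' {g | 0 < g.re} with hOdef
  have hO : IsOpen O := by
    refine ContinuousOn.isOpen_inter_preimage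
      (fun w hw => (continuousAt_symbol hα0 hw).continuousWithinAt) ?_
      (isOpen_lt continuous_const Complex.continuous_re)
    exact isOpen_splitPlane.preimage (by fun_prop)
  have hKO : K ⊆ O := by
    rintro w ⟨-, him, hn, hre⟩
    have h0 : w ≠ 0 := norm_pos_iff.1 (lt_of_lt_of_le (half_pos hε) hn)
    have hs := exp_neg_mem_splitPlane (mem_slitPlane_of_re_nonneg hre h0) him
    exact ⟨hs, re_symbol_pos hα0 hα1 hre h0 him hs⟩
  obtain ⟨r, hr, hrO⟩ := hK.exists_thickening_subset_open hO hKO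
  refine ⟨min (r / 2) (ε / 2), lt_min (half_pos hr) (half_pos hε), fun w him hn hN hre => ?_⟩
  rcases le_total 0 w.re with h | h
  · exact (hKO ⟨by simpa using hN, him, by rw [mem_ofPred_eq]; linarith, h⟩).2
  · have hd : ‖w - w.im * Complex.I‖ = |w.re| := by
      have : w - w.im * Complex.I = (w.re : ℂ) := by
        rw [sub_eq_iff_eq_add]; exact (Complex.re_add_im w).symm
      rw [this, Complex.norm_real, Real.norm_eq_abs]
    have hle : |w.re| ≤ min (r / 2) (ε / 2) := by rw [abs_of_nonpos h]; linarith
    have h1 := hle.trans (min_le_left _ _)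
    have h2 := hle.trans (min_le_right _ _)
    have hni : ‖(w.im : ℂ) * Complex.I‖ = |w.im| := by simp
    refine (hrO (Metric.mem_thickening_iff.2 ⟨w.im * Complex.I, ⟨?_, ?_, ?_, ?_⟩, ?_⟩)).2
    · rw [mem_closedBall_zero_iff, hni]
      exact (Complex.abs_im_le_norm w).trans hN
    · simpa using him
    · have := norm_sub_norm_le w (w.im * Complex.I)
      rw [mem_ofPred_eq]
      linarith
    · simp
    · rw [dist_eq_norm, hd]
      linarith

/-! ### The contour -/

theorem mul_ofReal_cpow {r : ℝ} (hr : 0 < r) (z : ℂ) (a : ℝ) :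
    (z * r) ^ (a : ℂ) = ((r ^ a : ℝ) : ℂ) * z ^ (a : ℂ) := by
  rw [Complex.cpow_ofReal, Complex.cpow_ofReal, mul_comm z, Complex.arg_real_mul z hr, norm_mul,
    Complex.norm_of_nonneg hr.le, Real.mul_rpow hr.le (norm_nonneg _)]
  push_cast
  ring

theorem arg_eq_of_eq_mul_exp {ρ θ : ℝ} (hρ : 0 < ρ) (hθ : θ ∈ Ioc (-Real.pi) Real.pi) :
    (ρ * Complex.exp (θ * Complex.I)).arg = θ := by
  have h := Complex.arg_mul_cos_add_sin_mul_I hρ hθ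
  rwa [Complex.exp_mul_I]

theorem contour_cases {θ δ : ℝ} {z : ℂ} (hθ : Real.pi / 2 < θ) (hθ' : θ < Real.pi) (hδ : 0 < δ)
    (hz : z ∈ contour θ δ) : z ≠ 0 ∧ |z.arg| ≤ θ ∧ (‖z‖ = δ ∨ |z.im| = ‖z‖ * Real.sin θ) := by
  have hπ := Real.pi_pos
  have hsin : 0 ≤ Real.sin θ := Real.sin_nonneg_of_nonneg_of_le_pi (by linarith) hθ'.le
  rcases hz with ⟨hn, ha⟩ | ⟨ρ, hρ, hz⟩
  · exact ⟨norm_pos_iff.1 (hn ▸ hδ), ha, Or.inl hn⟩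
  · have hρ0 : 0 < ρ := hδ.trans_le hρ
    have key : ∀ φ : ℝ, |φ| = θ → z = ρ * Complex.exp (φ * Complex.I) →
        z ≠ 0 ∧ |z.arg| ≤ θ ∧ (‖z‖ = δ ∨ |z.im| = ‖z‖ * Real.sin θ) := by
      intro φ hφ hz
      have hφ' := abs_lt.1 (hφ.trans_lt hθ')
      have harg : z.arg = φ := hz ▸ arg_eq_of_eq_mul_exp hρ0 ⟨hφ'.1, hφ'.2.le⟩
      refine ⟨?_, ?_, Or.inr ?_⟩
      · rw [hz]
        exact mul_ne_zero (by exact_mod_cast hρ0.ne') (Complex.exp_ne_zero _)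
      · rw [harg, hφ]
      · rw [← Complex.norm_mul_sin_arg z, abs_mul, abs_of_nonneg (norm_nonneg z), harg,
          Real.abs_sin_eq_sin_abs_of_abs_le_pi (hφ.trans_le hθ'.le), hφ]
    rcases hz with hz | hz
    · exact key θ (abs_of_pos (by linarith)) hz
    · exact key (-θ) (by rw [abs_neg, abs_of_pos (by linarith)]) (by rw [hz]; simp)

theorem truncatedContour_scaled {θ δ τ : ℝ} {z : ℂ} (hθ : Real.pi / 2 < θ)
    (hθ' : θ ≤ 3 * Real.pi / 4) (hτ : 0 < τ) (hδ : 0 < δ) (hδτ : δ < Real.pi / (2 * τ))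
    (hz : z ∈ truncatedContour θ δ τ) : z * τ ∈ Complex.slitPlane ∧ |(z * τ).im| ≤ Real.pi ∧
      ‖z * τ‖ ≤ 5 ∧ 5 * Real.cos θ ≤ (z * τ).re := by
  have hπ := Real.pi_pos
  have hπ' := Real.pi_lt_d2
  obtain ⟨h0, harg, hn⟩ := contour_cases hθ (by linarith) hδ hz.1
  have hnorm : ‖z * τ‖ = ‖z‖ * τ := by rw [norm_mul, Complex.norm_of_nonneg hτ.le]
  have him : |(z * τ).im| = |z.im| * τ := by
    rw [Complex.im_mul_ofReal, abs_mul, abs_of_pos hτ]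
  have hargw : (z * τ).arg = z.arg := by rw [mul_comm, Complex.arg_real_mul z hτ]
  have h0w : z * τ ≠ 0 := mul_ne_zero h0 (by exact_mod_cast hτ.ne')
  have himle : |(z * τ).im| ≤ Real.pi := by
    rw [him]; exact (le_div_iff₀ hτ).1 hz.2
  have hn5 : ‖z * τ‖ ≤ 5 := by
    rcases hn with hn | hn
    · rw [hnorm, hn]
      have := (lt_div_iff₀ (by positivity)).1 hδτ
      linarith
    -- Since `θ ≤ 3π / 4`, the sine is at least `√2 / 2`; on the rays `|w| sin θ ≤ π` then gives
    -- `|w| ≤ π / 0.7 < 5`.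
    · have hsin : 0.7 ≤ Real.sin θ := by
        have h1 : Real.cos (Real.pi / 4) ≤ Real.cos (θ - Real.pi / 2) :=
          Real.cos_le_cos_of_nonneg_of_le_pi (by linarith) (by linarith) (by linarith)
        rw [Real.cos_sub_pi_div_two, Real.cos_pi_div_four] at h1
        have : 1.4 ≤ Real.sqrt 2 := Real.le_sqrt_of_sq_le (by norm_num)
        linarith
      rw [him, hn, mul_right_comm, ← hnorm] at himle
      nlinarith [norm_nonneg (z * τ)]
  refine ⟨?_, himle, hn5, ?_⟩
  · rw [Complex.mem_slitPlane_iff_arg]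
    refine ⟨fun h => ?_, h0w⟩
    rw [← hargw, h, abs_of_pos hπ] at harg
    linarith
  · rw [← Complex.norm_mul_cos_arg, hargw, ← Real.cos_abs z.arg]
    have h1 : Real.cos θ ≤ Real.cos |z.arg| :=
      Real.cos_le_cos_of_nonneg_of_le_pi (abs_nonneg _) (by linarith) harg
    have h2 : Real.cos θ ≤ 0 := Real.cos_nonpos_of_pi_div_two_le_of_le hθ.le (by linarith)
    calc 5 * Real.cos θ ≤ ‖z * τ‖ * Real.cos θ := mul_le_mul_of_nonpos_right hn5 h2
      _ ≤ _ := by gcongr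

/-! ### Uniform bounds along the contour -/

theorem exists_symbol_sector {α : ℝ} (hα0 : 0 < α) (hα1 : α < 1) :
    ∃ s : ℝ, 0 < s ∧ ∃ η : ℝ, 0 < η ∧ ∀ w ∈ Complex.slitPlane, |w.im| ≤ Real.pi → ‖w‖ ≤ 5 →
      -η ≤ w.re → ∀ t : ℝ, 0 ≤ t → s * (‖w ^ (α : ℂ)‖ + t) ≤ ‖w ^ (α : ℂ) + t‖ ∧
        s * t ≤ ‖symbol α w + t‖ ∧ symbol α w + t ≠ 0 := by
  have hπ := Real.pi_pos
  obtain ⟨C, hC, hb⟩ := exists_norm_symbol_sub_cpow_le hα0 hα1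
  set s₀ := Real.cos (Real.pi * α / 2)
  have hs₀ : 0 < s₀ := Real.cos_pos_of_mem_Ioo ⟨by nlinarith, by nlinarith⟩
  have hs₁ : s₀ ≤ 1 := Real.cos_le_one _
  -- Below the radius `s₀ / (2 * C)` consistency puts the symbol within `s₀ / 2 * |w ^ α|` of `w ^
  -- α`, so half of the sector bound survives; beyond it `Re (symbol α w) > 0` gives `|symbol α w +
  -- t| ≥ t`.
  obtain ⟨η, hη, hre⟩ := exists_re_symbol_pos hα0 hα1 (show 0 < s₀ / (2 * C) by positivity)
  refine ⟨s₀ / 2, half_pos hs₀, η, hη, fun w hw him hN hwre t ht => ?_⟩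
  have hw0 := Complex.slitPlane_ne_zero hw
  have hW0 : 0 < ‖w ^ (α : ℂ)‖ := norm_pos_iff.2 (by simp [Complex.cpow_eq_zero_iff, hw0])
  have hW : s₀ * (‖w ^ (α : ℂ)‖ + t) ≤ ‖w ^ (α : ℂ) + t‖ := by
    have h := norm_cpow_add_ofReal_ge hα0 hα1 w ht
    rwa [show ‖w‖ ^ α = ‖w ^ (α : ℂ)‖ by rw [Complex.norm_cpow_of_ne_zero hw0]; simp] at h
  have hnn : 0 ≤ ‖w ^ (α : ℂ)‖ + t := by positivity
  refine ⟨by nlinarith, ?_⟩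
  rcases lt_or_ge ‖w‖ (s₀ / (2 * C)) with h | h
  · have h1 : ‖symbol α w - w ^ (α : ℂ)‖ ≤ s₀ / 2 * ‖w ^ (α : ℂ)‖ := by
      refine (hb w hw hN him).trans ?_
      rw [← mul_assoc]
      have : C * ‖w‖ ≤ s₀ / 2 := by
        rw [lt_div_iff₀ (by positivity)] at h
        linarith
      gcongr
    have h2 : ‖w ^ (α : ℂ) + t‖ ≤ ‖symbol α w + t‖ + ‖symbol α w - w ^ (α : ℂ)‖ := by
      have e : w ^ (α : ℂ) + t = (symbol α w + t) - (symbol α w - w ^ (α : ℂ)) := by ring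
      rw [e]; exact norm_sub_le _ _
    have h3 : s₀ / 2 * (‖w ^ (α : ℂ)‖ + t) ≤ ‖symbol α w + t‖ := by
      nlinarith [mul_nonneg hs₀.le ht]
    refine ⟨le_trans ?_ h3, norm_pos_iff.1 (lt_of_lt_of_le ?_ h3)⟩
    · gcongr; linarith
    · positivity
  · have hpos := hre w him h hN hwre
    have h1 : (symbol α w + t).re = (symbol α w).re + t := by simp
    have h2 := Complex.re_le_norm (symbol α w + t)
    refine ⟨?_, norm_pos_iff.1 (by linarith)⟩
    nlinarith

theorem chi1_eq (α : ℝ) {τ : ℝ} (z : ℂ) :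
    chi1 α τ z = symbol α (z * τ) / ((τ ^ α : ℝ) : ℂ) := by
  rw [chi1, symbol]; ring

theorem resolvent_scaling {r t : ℝ} (hr : 0 < r) (μ : ℂ) :
    (μ / r + t)⁻¹ * t = (μ + (r * t : ℝ))⁻¹ * (r * t : ℝ) := by
  have hr0 : (r : ℂ) ≠ 0 := by exact_mod_cast hr.ne'
  have e : μ / r + t = (μ + (r * t : ℝ)) / r := by push_cast; field_simp
  rw [e, inv_div]
  push_cast
  ring

end L1Scheme

/-! ### The kernel estimate. -/

theorem mainTheorem5 (α : ℝ) (hα0 : 0 < α) (hα1 : α < 1) :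
    ∃ θ₀ : ℝ, Real.pi / 2 < θ₀ ∧ θ₀ ≤ Real.pi ∧
      ∀ θ : ℝ, Real.pi / 2 < θ → θ < θ₀ →
        ∃ c : ℝ, 0 < c ∧
          ∀ (d : ℕ), 1 ≤ d → d ≤ 3 →
          ∀ (Ω : Set (EuclideanSpace ℝ (Fin d))), L1Scheme.IsConvexPolygonalDomain Ω →
          ∀ (T : L1Scheme.Triangulation Ω) (τ δ : ℝ), 0 < τ → 0 < δ → δ < Real.pi / (2 * τ) →
          ∀ z ∈ L1Scheme.truncatedContour θ δ τ,
            Complex.exp (-(z * τ)) ∈ L1Scheme.splitPlane ∧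
            IsUnit (z ^ (α : ℂ) • (1 : T.feSpace →L[ℂ] T.feSpace) + T.negLaplacian) ∧
            IsUnit (L1Scheme.chi1 α τ z • (1 : T.feSpace →L[ℂ] T.feSpace) + T.negLaplacian) ∧
            ‖L1Scheme.kernelOne T.negLaplacian α z - L1Scheme.kernelTwo T.negLaplacian α τ z‖
              ≤ c * τ := by
  have hπ := Real.pi_pos
  obtain ⟨s, hs, η, hη, hsec⟩ := L1Scheme.exists_symbol_sector hα0 hα1
  obtain ⟨C₁, hC₁, hb⟩ := L1Scheme.exists_norm_symbol_sub_cpow_le hα0 hα1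
  obtain ⟨C₂, hq⟩ := L1Scheme.exists_norm_inv_sub_inv_le 5
  -- The bound `π / 4` keeps the scaled contour in the disc of radius `5`; the bound `η / 5` gives
  -- `5 cos θ ≥ -5 (θ - π / 2) ≥ -η`, so it stays in the strip where the symbol is controlled.
  refine ⟨Real.pi / 2 + min (Real.pi / 4) (η / 5),
    lt_add_of_pos_right _ (lt_min (by positivity) (by positivity)),
    by linarith [min_le_left (Real.pi / 4) (η / 5)], fun θ hθ hθ₀ =>
    ⟨|C₂ / s + C₁ / s ^ 2| + 1, by positivity, ?_⟩⟩
  intro d _ _ Ω _ T τ δ hτ hδ hδτ z hz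
  have hθ4 : θ - Real.pi / 2 ≤ Real.pi / 4 := by linarith [min_le_left (Real.pi / 4) (η / 5)]
  have hθη : θ - Real.pi / 2 ≤ η / 5 := by linarith [min_le_right (Real.pi / 4) (η / 5)]
  obtain ⟨hw, him, hN, hre⟩ :=
    L1Scheme.truncatedContour_scaled hθ (by linarith) hτ hδ hδτ hz
  have hcos : -η ≤ 5 * Real.cos θ := by
    have h1 := Real.sin_le (show 0 ≤ θ - Real.pi / 2 by linarith)
    rw [Real.sin_sub_pi_div_two] at h1
    linarith
  have hw0 := Complex.slitPlane_ne_zero hw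
  have hsec' := hsec _ hw him hN (hcos.trans hre)
  have hτα : 0 < τ ^ α := Real.rpow_pos_of_pos hτ α
  have hταc : ((τ ^ α : ℝ) : ℂ) ≠ 0 := by exact_mod_cast hτα.ne'
  have hτc : (τ : ℂ) ≠ 0 := by exact_mod_cast hτ.ne'
  have hz0 : z ≠ 0 := left_ne_zero_of_mul hw0
  have hA : T.negLaplacian.IsPositive :=
    ContinuousLinearMap.isPositive_adjoint_comp_self _
  have hzα : z ^ (α : ℂ) = (z * τ) ^ (α : ℂ) / ((τ ^ α : ℝ) : ℂ) := by
    rw [L1Scheme.mul_ofReal_cpow hτ]; field_simp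
  have hadd : ∀ (μ : ℂ) (t : ℝ), μ / ((τ ^ α : ℝ) : ℂ) + t =
      (μ + (τ ^ α * t : ℝ)) / ((τ ^ α : ℝ) : ℂ) := fun μ t => by
    push_cast at hταc ⊢; field_simp
  have hWne : (z * τ) ^ (α : ℂ) ≠ 0 := by simp [Complex.cpow_eq_zero_iff, hw0]
  have hμ : ∀ t : ℝ, 0 ≤ t → z ^ (α : ℂ) + t ≠ 0 := fun t ht => by
    rw [hzα, hadd]
    refine div_ne_zero (norm_pos_iff.1 (lt_of_lt_of_le ?_ (hsec' _ (mul_nonneg hτα.le ht)).1)) hταc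
    have := norm_pos_iff.2 hWne
    positivity
  have hν : ∀ t : ℝ, 0 ≤ t → L1Scheme.chi1 α τ z + t ≠ 0 := fun t ht => by
    rw [L1Scheme.chi1_eq, hadd]
    exact div_ne_zero (hsec' _ (mul_nonneg hτα.le ht)).2.2 hταc
  refine ⟨L1Scheme.exp_neg_mem_splitPlane hw him, (L1Scheme.cfc_resolvent_mul hA hμ).1,
    (L1Scheme.cfc_resolvent_mul hA hν).1, ?_⟩
  rw [L1Scheme.kernelOne, L1Scheme.kernelTwo, neg_sub_neg]
  refine L1Scheme.norm_resolvent_difference_le hA hν hμ fun t ht => ?_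
  rw [norm_sub_rev]
  have ht' : 0 ≤ τ ^ α * t := mul_nonneg hτα.le ht
  obtain ⟨h1, h2, h3⟩ := hsec' _ ht'
  -- The scalar estimate is used at `τ ^ α * t` instead of `t`, which absorbs the powers of `τ` in
  -- both resolvents.
  have hmain := L1Scheme.norm_symbol_difference_le (w := z * τ) (W := (z * τ) ^ (α : ℂ))
    (G := L1Scheme.symbol α (z * τ)) (q := (1 - Complex.exp (-(z * τ)))⁻¹) hs hw0 hWne ht'
    (le_trans (by gcongr; linarith) h1) h2 h3 (hb _ hw hN him) (hq _ hw0 hN him)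
  rw [hzα, L1Scheme.chi1_eq, L1Scheme.resolvent_scaling hτα, L1Scheme.resolvent_scaling hτα]
  have e : ∀ X Y : ℂ, z⁻¹ * X - (τ : ℂ) / (1 - Complex.exp (-(z * τ))) * Y =
      τ * ((z * τ)⁻¹ * X - (1 - Complex.exp (-(z * τ)))⁻¹ * Y) := fun X Y => by
    rw [mul_inv, div_eq_mul_inv]; field_simp
  rw [e, norm_mul, Complex.norm_of_nonneg hτ.le, mul_comm]
  gcongr
  exact hmain.trans (by linarith [le_abs_self (C₂ / s + C₁ / s ^ 2)])
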